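/- Let $X$ be a complex Banach space, $\mathcal B(X)$ the bounded linear operators on $X$ and $\mathcal F(X)$ those of finite rank. For $F\in\mathcal F(X)$ with range $R$ and restriction $F_R:R\to R$ put $\det(I-F)=\det(I_R-F_R)$, $\operatorname{tr}(F)=\operatorname{tr}(F_R)$ and, for $p>0$, $\det_p(I-F)=\det(I-F)\exp\Big(\sum_{k=1}^{\lceil p\rceil-1}\frac1k\operatorname{tr}(F^k)\Big)$. Let $p>0$. An *$l_p$-ideal* in $\mathcal B(X)$ is a linear subspace $\mathcal I\subset\mathcal B(X)$ with a quasi-norm $\|\cdot\|_{\mathcal I}$ (a norm, except that the triangle inequality is only required in the form $\|K+L\|_{\mathcal I}\le q(\|K\|_{\mathcal I}+\|L\|_{\mathcal I})$ for some constant $q\ge1$) such that: $\mathcal F(X)$ is contained and dense in $(\mathcal I,\|\cdot\|_{\mathcal I})$; $\|L\|\le\|L\|_{\mathcal I}$ for $L\in\mathcal I$; if $L\in\mathcal I$ and $A,B\in\mathcal B(X)$ then $ALB\in\mathcal I$ and $\|ALB\|_{\mathcal I}\le\|A\|\,\|L\|_{\mathcal I}\,\|B\|$; and there is a constant $\gamma_p$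 such that $\big(\sum_j|\lambda_j(L)|^p\big)^{1/p}\le\gamma_p\|L\|_{\mathcal I}$ for all $L\in\mathcal I$, where $(\lambda_j(L))$ are the discrete eigenvalues of $L$ (isolated eigenvalues with Riesz projection of finite rank), each repeated according to its algebraic multiplicity (the rank of the Riesz projection). **Proposition 4.7.** Let $p>0$ and let $(\mathcal I,\|\cdot\|_{\mathcal I})$ be an $l_p$-ideal in $\mathcal B(X)$. Then there is exactly one function $L\mapsto\det_{p,\mathcal I}(I-L)$ from $\mathcal I$ to $\mathbb C$ that is continuous with respect to $\|\cdot\|_{\mathcal I}$ and satisfies $\det_{p,\mathcal I}(I-F)=\det_p(I-F)$ for all $F\in\mathcal F(X)$. Moreover, for all $L\in\mathcal I$, $F\in\mathcal F(X)$ and $B\in\mathcal B(X)$: (i) $\det_{p,\mathcal I}(I-LB)=\det_{p,\mathcal I}(I-BL)$. (ii) If $H:=F+L-FL$, so that $(I-F)(I-L)=I-H$ and $H\in\mathcal I$, then $$\det\nolimits_{p,\mathcal I}((I-F)(I-L))=\det(I-F)\,\det\nolimits_{p,\mathcal I}(I-L)\,\exp\Big(\sum_{k=1}^{\lceil p\rceil-1}\sum_{m=0}^{k-1}\frac{\operatorname{tr}\big(F(I-L)L^mH^{k-1-m}\big)}{k}\Big).$$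 (iii) $\det_{p,\mathcal I}(I-L)\ne0$ if and only if $I-L$ is invertible in $\mathcal B(X)$. -/

import Mathlib

noncomputable section

namespace RegDet

variable {X : Type*} [NormedAddCommGroup X] [NormedSpace ℂ X]

/-! ### Finite rank operators, their determinant and trace -/

/-- The bounded operator `F` has finite rank: its range is finite-dimensional. -/
def FiniteRank (F : X →L[ℂ] X) : Prop :=
  FiniteDimensional ℂ (LinearMap.range (F : X →ₗ[ℂ] X))

/-- The restriction `F_R : R → R` of `F` to its own range `R`. -/
def onRange (F : X →L[ℂ] X) :
    LinearMap.range (F : X →ₗ[ℂ] X) →ₗ[ℂ] LinearMap.range (F : X →ₗ[ℂ] X) :=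
  (F : X →ₗ[ℂ] X).restrict (fun x _ => LinearMap.mem_range_self _ x)

/-- `det (I - F) := det (I_R - F_R)` for `F` of finite rank with range `R`. -/
def detOneSub (F : X →L[ℂ] X) : ℂ := LinearMap.det (1 - onRange F)

/-- `tr F := tr F_R` for `F` of finite rank with range `R`. -/
def tr (F : X →L[ℂ] X) : ℂ := LinearMap.trace ℂ _ (onRange F)

/-- `det_p (I - F) = det (I - F) * exp (∑_{k=1}^{⌈p⌉-1} tr (F^k) / k)` for `F` of finite rank. -/
def regDetFin (p : ℝ) (F : X →L[ℂ] X) : ℂ :=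
  detOneSub F * Complex.exp (∑ k ∈ Finset.Ico 1 ⌈p⌉₊, tr (F ^ k) / (k : ℂ))

/-! ### Discrete eigenvalues and algebraic multiplicity -/

/-- The closed disc of radius `r > 0` around `z` contains no point of the spectrum of `Z` apart
from (possibly) `z`. -/
def IsIsolatingRadius (Z : X →L[ℂ] X) (z : ℂ) (r : ℝ) : Prop :=
  0 < r ∧ spectrum ℂ Z ∩ Metric.closedBall z r ⊆ {z}

open Classical in
/-- The Riesz projection `(2πi)⁻¹ ∮ (μ - Z)⁻¹ dμ` over a circle around `z` of any radius that is
small enough to exclude the rest of the spectrum (and `0` if there is no such radius). -/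
def rieszProjection (Z : X →L[ℂ] X) (z : ℂ) : X →L[ℂ] X :=
  if h : ∃ r, IsIsolatingRadius Z z r then
    (2 * Real.pi * Complex.I : ℂ)⁻¹ • ∮ μ in C(z, h.choose), resolvent Z μ
  else 0

/-- The algebraic multiplicity of an isolated eigenvalue: the rank of its Riesz projection. -/
def algMult (Z : X →L[ℂ] X) (z : ℂ) : ℕ :=
  Module.finrank ℂ (LinearMap.range (rieszProjection Z z : X →ₗ[ℂ] X))

/-- The discrete spectrum: the eigenvalues that are isolated points of the spectrum and have
finite algebraic multiplicity. -/
def discreteSpectrum (Z : X →L[ℂ] X) : Set ℂ :=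
  {z | Module.End.HasEigenvalue (Z : X →ₗ[ℂ] X) z ∧ (∃ r, IsIsolatingRadius Z z r) ∧
    FiniteRank (rieszProjection Z z)}

open scoped ENNReal in
/-- `‖(λ_j(L))‖_{l_p} = (∑_j |λ_j(L)|^p)^{1/p}`, a value in `[0, ∞]`, where `(λ_j(L))` lists the
discrete eigenvalues of `L`, each repeated according to its algebraic multiplicity. -/
def eigenvalueLpNorm (p : ℝ) (L : X →L[ℂ] X) : ℝ≥0∞ :=
  (∑' z : discreteSpectrum L, (algMult L z : ℝ≥0∞) * ENNReal.ofReal (‖(z : ℂ)‖ ^ p)) ^ (1 / p)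

/-! ### Quasi-norms and `l_p`-ideals -/

/-- `N` is a quasi-norm on the complex vector space `V`. -/
structure IsQuasiNorm {V : Type*} [AddCommGroup V] [Module ℂ V] (N : V → ℝ) : Prop where
  nonneg : ∀ x, 0 ≤ N x
  eq_zero_iff : ∀ x, N x = 0 ↔ x = 0
  quasi_triangle : ∃ q : ℝ, 1 ≤ q ∧ ∀ x y, N (x + y) ≤ q * (N x + N y)
  smul : ∀ (c : ℂ) (x : V), N (c • x) = ‖c‖ * N x

/-- Continuity of `D : V → ℂ` for the topology that the quasi-norm `N` induces on `V`, in which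
the sets `{y | N (y - x) < δ}`, `δ > 0`, form a base of neighbourhoods of `x`. -/
def QuasiContinuous {V : Type*} [AddCommGroup V] (N : V → ℝ) (D : V → ℂ) : Prop :=
  ∀ x : V, ∀ ε : ℝ, 0 < ε → ∃ δ : ℝ, 0 < δ ∧ ∀ y : V, N (y - x) < δ → ‖D y - D x‖ < ε

open scoped NNReal ENNReal in
/-- `(𝓘, N)` is an `l_p`-ideal in `B(X)`. -/
structure IsLpIdeal (p : ℝ) (𝓘 : Submodule ℂ (X →L[ℂ] X)) (N : 𝓘 → ℝ) : Prop where
  quasiNorm : IsQuasiNorm N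
  /-- The finite rank operators belong to `𝓘` ... -/
  finiteRank_mem : ∀ F : X →L[ℂ] X, FiniteRank F → F ∈ 𝓘
  /-- ... and are dense in it with respect to `N`. -/
  dense : ∀ (L : 𝓘) (ε : ℝ), 0 < ε → ∃ F : 𝓘, FiniteRank (F : X →L[ℂ] X) ∧ N (F - L) < ε
  opNorm_le : ∀ L : 𝓘, ‖(L : X →L[ℂ] X)‖ ≤ N L
  mul_mul_mem : ∀ (A : X →L[ℂ] X) (L : 𝓘) (B : X →L[ℂ] X), A * (L : X →L[ℂ] X) * B ∈ 𝓘
  norm_mul_mul_le : ∀ (A : X →L[ℂ] X) (L : 𝓘) (B : X →L[ℂ] X),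
    N ⟨A * (L : X →L[ℂ] X) * B, mul_mul_mem A L B⟩ ≤ ‖A‖ * N L * ‖B‖
  /-- Eigenvalue type `l_p`, with some eigenvalue constant `γ`. -/
  eigenvalue_le : ∃ γ : ℝ≥0, ∀ L : 𝓘,
    eigenvalueLpNorm p (L : X →L[ℂ] X) ≤ (γ : ℝ≥0∞) * ENNReal.ofReal (N L)

/-- `D`, thought of as `L ↦ det_{p,𝓘} (I - L)`, is a continuous function on `(𝓘, N)` that agrees
with `F ↦ det_p (I - F)` on the finite rank operators. -/
structure IsRegDet (p : ℝ) (𝓘 : Submodule ℂ (X →L[ℂ] X)) (N : 𝓘 → ℝ) (D : 𝓘 → ℂ) : Prop where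
  continuous : QuasiContinuous N D
  extends_fin : ∀ F : 𝓘, FiniteRank (F : X →L[ℂ] X) → D F = regDetFin p (F : X →L[ℂ] X)

open Classical in
/-- The `p`-regularized determinant `L ↦ det_{p,𝓘} (I - L)`: the continuous extension of
`F ↦ det_p (I - F)` from the finite rank operators to `(𝓘, N)` (and `0` if there is none). -/
def regDet (p : ℝ) (𝓘 : Submodule ℂ (X →L[ℂ] X)) (N : 𝓘 → ℝ) : 𝓘 → ℂ :=
  if h : ∃ D : 𝓘 → ℂ, IsRegDet p 𝓘 N D then h.choose else 0

variable {p : ℝ} {𝓘 : Submodule ℂ (X →L[ℂ] X)} {N : 𝓘 → ℝ}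

theorem IsLpIdeal.mul_right_mem (h : IsLpIdeal p 𝓘 N) (L : 𝓘) (B : X →L[ℂ] X) :
    (L : X →L[ℂ] X) * B ∈ 𝓘 := by
  simpa using h.mul_mul_mem 1 L B

theorem IsLpIdeal.mul_left_mem (h : IsLpIdeal p 𝓘 N) (B : X →L[ℂ] X) (L : 𝓘) :
    B * (L : X →L[ℂ] X) ∈ 𝓘 := by
  simpa using h.mul_mul_mem B L 1

/-- `I - (I - F)(I - L) = F + L - FL` belongs to `𝓘` for `F` of finite rank and `L ∈ 𝓘`. -/
theorem IsLpIdeal.one_sub_mul_mem (h : IsLpIdeal p 𝓘 N) {F : X →L[ℂ] X} (hF : FiniteRank F)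
    (L : 𝓘) : 1 - (1 - F) * (1 - (L : X →L[ℂ] X)) ∈ 𝓘 := by
  have e : 1 - (1 - F) * (1 - (L : X →L[ℂ] X)) = F + L - F * L := by noncomm_ring
  rw [e]
  exact 𝓘.sub_mem (𝓘.add_mem (h.finiteRank_mem F hF) L.2) (h.mul_left_mem F L)

end RegDet

end

/-!
For `F` of finite rank, `det_p (I - F)` is the product of Weierstrass' elementary factors over the
nonzero eigenvalues of `F`, so the `l_p` bound on eigenvalues bounds it on every ball of `𝓘`. As it
is entire along complex lines, the Schwarz lemma makes it Lipschitz on bounded sets, and it extends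
continuously from the dense subspace of finite rank operators. The identities (i) and (ii) pass to
the limit from that subspace. For (iii), the factors are bounded away from `0` near `0`, which makes
the determinant nonzero on a neighbourhood of `0` in `𝓘`; in general `I - L = (I - F) (I - K)` with
`F` of finite rank and `K` small, and (ii) reduces the question to `det (I - F)`.
-/

noncomputable section

namespace RegDet

/-! ### Determinants and traces in finite dimension -/

section

open Module

section LinearAlgebra

theorem det_one_sub_comp_comm {R V W : Type*} [CommRing R]
    [AddCommGroup V] [Module R V] [Module.Free R V] [Module.Finite R V]
    [AddCommGroup W] [Module R W] [Module.Free R W] [Module.Finite R W]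
    (f : V →ₗ[R] W) (g : W →ₗ[R] V) :
    LinearMap.det (1 - g ∘ₗ f) = LinearMap.det (1 - f ∘ₗ g) := by
  classical
  let b := Free.chooseBasis R V
  let c := Free.chooseBasis R W
  rw [← LinearMap.det_toMatrix b, ← LinearMap.det_toMatrix c, map_sub, map_sub,
    LinearMap.toMatrix_one, LinearMap.toMatrix_one, LinearMap.toMatrix_comp b c b,
    LinearMap.toMatrix_comp c b c, Matrix.det_one_sub_mul_comm]

theorem trace_pow_of_isNilpotent_sub {R V : Type*} [CommRing R] [IsReduced R] [Nontrivial R]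
    [AddCommGroup V] [Module R V] [Module.Free R V] [Module.Finite R V]
    {T : End R V} {μ : R} (hT : IsNilpotent (T - algebraMap R (End R V) μ)) (k : ℕ) :
    LinearMap.trace R V (T ^ k) = finrank R V * μ ^ k := by
  induction k with
  | zero => simp
  | succ k ih =>
    rw [pow_succ, End.mul_eq_comp, LinearMap.trace_comp_eq_mul_of_commute_of_isNilpotent μ
      ((Commute.refl T).pow_left k) hT, ih]
    ring

variable {K V : Type*} [Field K] [IsAlgClosed K] [AddCommGroup V] [Module K V]
  [FiniteDimensional K V]

theorem trace_pow_eq_sum_roots_charpoly (T : End K V) (k : ℕ) :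
    LinearMap.trace K V (T ^ k) = (T.charpoly.roots.map (· ^ k)).sum := by
  classical
  have hmaps (μ : K) : Set.MapsTo T (T.maxGenEigenspace μ) (T.maxGenEigenspace μ) :=
    T.mapsTo_maxGenEigenspace_of_comm rfl μ
  have hmaps_pow (μ : K) : Set.MapsTo (T ^ k) (T.maxGenEigenspace μ) (T.maxGenEigenspace μ) :=
    T.mapsTo_maxGenEigenspace_of_comm ((Commute.refl T).pow_right k) μ
  have htrace (μ : K) : LinearMap.trace K _ ((T ^ k).restrict (hmaps_pow μ)) =
      T.charpoly.rootMultiplicity μ * μ ^ k := by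
    rw [← Module.End.pow_restrict k (hmaps μ), trace_pow_of_isNilpotent_sub
      (T.isNilpotent_restrict_maxGenEigenspace_sub_algebraMap μ),
      LinearMap.finrank_maxGenEigenspace_eq]
  have hinternal := DirectSum.isInternal_submodule_of_iSupIndep_of_iSup_eq_top
    T.independent_maxGenEigenspace T.iSup_maxGenEigenspace_eq_top
  have hfin : {μ | T.maxGenEigenspace μ ≠ ⊥}.Finite :=
    WellFoundedGT.finite_ne_bot_of_iSupIndep T.independent_maxGenEigenspace
  have hroots : hfin.toFinset = T.charpoly.roots.toFinset := by
    ext μ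
    rw [Set.Finite.mem_toFinset, Multiset.mem_toFinset, ← Multiset.count_pos,
      Polynomial.count_roots, ← LinearMap.finrank_maxGenEigenspace_eq]
    exact Submodule.one_le_finrank_iff.symm
  rw [LinearMap.trace_eq_sum_trace_restrict' hinternal hfin hmaps_pow, hroots,
    Finset.sum_multiset_map_count]
  simp only [htrace, Polynomial.count_roots, nsmul_eq_mul]

theorem det_one_sub_eq_prod_roots_charpoly (T : End K V) :
    LinearMap.det (1 - T) = (T.charpoly.roots.map (1 - ·)).prod := by
  have hprod := (IsAlgClosed.splits T.charpoly).eq_prod_roots_of_monic T.charpoly_monic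
  rw [← map_one (algebraMap K (End K V)), ← LinearMap.eval_charpoly, hprod,
    Polynomial.eval_multiset_prod, Multiset.map_map, ← hprod]
  simp

end LinearAlgebra

section DifferentiableMatrix

variable {𝕜 n : Type*} [NontriviallyNormedField 𝕜] [Fintype n] [DecidableEq n]
  {A : 𝕜 → Matrix n n 𝕜}

theorem differentiable_matrix_det (hA : ∀ i j, Differentiable 𝕜 fun x => A x i j) :
    Differentiable 𝕜 fun x => (A x).det := by
  simp only [Matrix.det_apply]
  exact Differentiable.fun_sum fun σ _ => Differentiable.const_smul
    (Differentiable.fun_finsetProd fun i _ => hA (σ i) i) _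

theorem differentiable_matrix_pow_apply (hA : ∀ i j, Differentiable 𝕜 fun x => A x i j) (k : ℕ)
    (i j : n) : Differentiable 𝕜 fun x => (A x ^ k) i j := by
  induction k generalizing i j with
  | zero => simp
  | succ k ih =>
    simp only [pow_succ, Matrix.mul_apply]
    exact Differentiable.fun_sum fun l _ => (ih i l).mul (hA l j)

end DifferentiableMatrix

section RegularizedDeterminant

/-- The elementary factor `(1 - z) exp (z + z ^ 2 / 2 + ⋯ + z ^ (m - 1) / (m - 1))`, which is
Weierstrass' `E_{m-1}`. The shift of the index makes `m = ⌈p⌉` the order that belongs to `det_p`. -/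
def elemFactor (m : ℕ) (z : ℂ) : ℂ :=
  (1 - z) * Complex.exp (∑ k ∈ Finset.Ico 1 m, z ^ k / (k : ℂ))

variable {V : Type*} [AddCommGroup V] [Module ℂ V]

/-- The regularized determinant `det_m (I - T)` of an endomorphism `T` of a finite-dimensional
space, to which `regDetFin` reduces for any finite-dimensional space that factors the operator. -/
def regDetEnd (m : ℕ) (T : End ℂ V) : ℂ :=
  LinearMap.det (1 - T) *
    Complex.exp (∑ k ∈ Finset.Ico 1 m, LinearMap.trace ℂ V (T ^ k) / (k : ℂ))

variable [FiniteDimensional ℂ V]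

theorem regDetEnd_eq_prod_roots_charpoly (m : ℕ) (T : End ℂ V) :
    regDetEnd m T = (T.charpoly.roots.map (elemFactor m)).prod := by
  have hsum : ∑ k ∈ Finset.Ico 1 m, LinearMap.trace ℂ V (T ^ k) / (k : ℂ) =
      (T.charpoly.roots.map fun z => ∑ k ∈ Finset.Ico 1 m, z ^ k / (k : ℂ)).sum := by
    simp only [trace_pow_eq_sum_roots_charpoly, ← Multiset.sum_map_div]
    exact Multiset.sum_map_sum_map _ _
  rw [regDetEnd, det_one_sub_eq_prod_roots_charpoly, hsum, Complex.exp_multiset_sum,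
    Multiset.map_map, ← Multiset.prod_map_mul]
  rfl

theorem differentiable_regDetEnd_add_smul (m : ℕ) (S T : End ℂ V) :
    Differentiable ℂ fun z : ℂ => regDetEnd m (S + z • T) := by
  let b := finBasis ℂ V
  have hentry (i j) : Differentiable ℂ fun z : ℂ => LinearMap.toMatrix b b (S + z • T) i j := by
    simp only [map_add, map_smul, Matrix.add_apply, Matrix.smul_apply, smul_eq_mul]
    fun_prop
  have hdet : Differentiable ℂ fun z : ℂ => LinearMap.det (1 - (S + z • T)) := by
    simp only [← LinearMap.det_toMatrix b, map_sub]
    exact differentiable_matrix_det fun i j => (differentiable_const _).sub (hentry i j)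
  have htrace (k : ℕ) : Differentiable ℂ fun z : ℂ => LinearMap.trace ℂ V ((S + z • T) ^ k) := by
    simp only [LinearMap.trace_eq_matrix_trace ℂ b, ← LinearMap.toMatrix_pow, Matrix.trace]
    exact Differentiable.fun_sum fun i _ => differentiable_matrix_pow_apply hentry k i i
  exact hdet.mul (Differentiable.fun_sum fun k _ => (htrace k).div_const _).cexp

end RegularizedDeterminant

end

/-! ### Operators of finite rank -/

section

open Module

section Spectrum

variable {𝕜 E F : Type*} [NontriviallyNormedField 𝕜] [NormedAddCommGroup E] [NormedSpace 𝕜 E]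
  [NormedAddCommGroup F] [NormedSpace 𝕜 F] {f : E →L[𝕜] F} {g : F →L[𝕜] E} {z : 𝕜}

theorem mem_resolventSet_comp_of_mem (hz : z ≠ 0) (h : z ∈ resolventSet 𝕜 (f ∘L g)) :
    z ∈ resolventSet 𝕜 (g ∘L f) := by
  obtain ⟨S, hS⟩ := h
  rw [Algebra.algebraMap_eq_smul_one] at hS
  have hright (y : F) : z • (↑S⁻¹ : F →L[𝕜] F) y - f (g ((↑S⁻¹ : F →L[𝕜] F) y)) = y := by
    simpa [hS] using DFunLike.congr_fun S.mul_inv y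
  have hleft (y : F) : (↑S⁻¹ : F →L[𝕜] F) (z • y - f (g y)) = y := by
    simpa [hS] using DFunLike.congr_fun S.inv_mul y
  rw [spectrum.mem_resolventSet_iff, Algebra.algebraMap_eq_smul_one]
  refine ⟨⟨z • 1 - g ∘L f, z⁻¹ • (1 + g ∘L ↑S⁻¹ ∘L f), ?_, ?_⟩, rfl⟩
  · rw [mul_smul_comm, inv_smul_eq_iff₀ hz]
    ext x
    have hx := congrArg g (hright (f x))
    simp only [map_sub, map_smul] at hx
    simp only [mul_apply_eq_comp, add_apply, sub_apply, smul_apply, one_apply_eq_self,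
      ContinuousLinearMap.comp_apply, map_add]
    rw [hx]
    abel
  · rw [smul_mul_assoc, inv_smul_eq_iff₀ hz]
    ext x
    have hx := congrArg g (hleft (f x))
    simp only [map_sub, map_smul] at hx
    simp only [mul_apply_eq_comp, add_apply, sub_apply, smul_apply, one_apply_eq_self,
      ContinuousLinearMap.comp_apply, map_sub, map_smul]
    rw [smul_add, sub_eq_iff_eq_add.1 hx]
    abel

theorem mem_spectrum_comp_comm (hz : z ≠ 0) :
    z ∈ spectrum 𝕜 (g ∘L f) ↔ z ∈ spectrum 𝕜 (f ∘L g) :=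
  not_congr ⟨mem_resolventSet_comp_of_mem hz, mem_resolventSet_comp_of_mem hz⟩

end Spectrum

variable {X : Type*} [NormedAddCommGroup X] [NormedSpace ℂ X] {F G : X →L[ℂ] X} {p : ℝ}

theorem FiniteRank.of_range_le (W : Submodule ℂ X) [FiniteDimensional ℂ W]
    (h : LinearMap.range (F : X →ₗ[ℂ] X) ≤ W) : FiniteRank F :=
  Submodule.finiteDimensional_of_le h

theorem FiniteRank.mul_right (hF : FiniteRank F) (A : X →L[ℂ] X) : FiniteRank (F * A) :=
  have : FiniteDimensional ℂ (LinearMap.range (F : X →ₗ[ℂ] X)) := hF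
  .of_range_le _ (LinearMap.range_comp_le_range (A : X →ₗ[ℂ] X) (F : X →ₗ[ℂ] X))

theorem FiniteRank.mul_left (hF : FiniteRank F) (A : X →L[ℂ] X) : FiniteRank (A * F) :=
  have : FiniteDimensional ℂ (LinearMap.range (F : X →ₗ[ℂ] X)) := hF
  .of_range_le _ (LinearMap.range_comp (F : X →ₗ[ℂ] X) (A : X →ₗ[ℂ] X)).le

theorem FiniteRank.exists_eq_subtype_comp (hF : FiniteRank F) (hG : FiniteRank G) :
    ∃ (W : Submodule ℂ X) (S T : X →ₗ[ℂ] W), FiniteDimensional ℂ W ∧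
      (F : X →ₗ[ℂ] X) = W.subtype ∘ₗ S ∧ (G : X →ₗ[ℂ] X) = W.subtype ∘ₗ T :=
  have : FiniteDimensional ℂ (LinearMap.range (F : X →ₗ[ℂ] X)) := hF
  have : FiniteDimensional ℂ (LinearMap.range (G : X →ₗ[ℂ] X)) := hG
  ⟨LinearMap.range (F : X →ₗ[ℂ] X) ⊔ LinearMap.range (G : X →ₗ[ℂ] X),
    (F : X →ₗ[ℂ] X).codRestrict _ fun x => Submodule.mem_sup_left ⟨x, rfl⟩,
    (G : X →ₗ[ℂ] X).codRestrict _ fun x => Submodule.mem_sup_right ⟨x, rfl⟩,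
    inferInstance, rfl, rfl⟩

section Factorization

variable {V : Type*} [AddCommGroup V] [Module ℂ V]
  {J : V →ₗ[ℂ] X} {S : X →ₗ[ℂ] V}

/-- The intermediate space is the range `W` of `J`: both `F_R` and `S J` arise from `F|_W` by
exchanging two factors. -/
theorem exists_onRange_eq_comp (h : (F : X →ₗ[ℂ] X) = J ∘ₗ S) :
    ∃ (a : LinearMap.range J →ₗ[ℂ] LinearMap.range (F : X →ₗ[ℂ] X))
      (b : LinearMap.range (F : X →ₗ[ℂ] X) →ₗ[ℂ] LinearMap.range J)
      (c : V →ₗ[ℂ] LinearMap.range J) (d : LinearMap.range J →ₗ[ℂ] V),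
      onRange F = a ∘ₗ b ∧ b ∘ₗ a = c ∘ₗ d ∧ S ∘ₗ J = d ∘ₗ c := by
  refine ⟨(F : X →ₗ[ℂ] X).rangeRestrict ∘ₗ (LinearMap.range J).subtype,
    Submodule.inclusion (h ▸ LinearMap.range_comp_le_range S J), J.rangeRestrict,
    S ∘ₗ (LinearMap.range J).subtype, rfl, ?_, rfl⟩
  ext x
  exact LinearMap.congr_fun h (x : X)

variable [FiniteDimensional ℂ V]

theorem FiniteRank.of_eq_comp (h : (F : X →ₗ[ℂ] X) = J ∘ₗ S) : FiniteRank F :=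
  .of_range_le (LinearMap.range J) (h ▸ LinearMap.range_comp_le_range S J)

theorem detOneSub_eq_of_eq_comp (h : (F : X →ₗ[ℂ] X) = J ∘ₗ S) :
    detOneSub F = LinearMap.det (1 - S ∘ₗ J) := by
  have : FiniteDimensional ℂ (LinearMap.range (F : X →ₗ[ℂ] X)) := FiniteRank.of_eq_comp h
  obtain ⟨a, b, c, d, hab, hba, hdc⟩ := exists_onRange_eq_comp h
  rw [detOneSub, hab, hdc, det_one_sub_comp_comm, hba, det_one_sub_comp_comm]

theorem detOneSub_mul_of_eq_comp {T : X →ₗ[ℂ] V} (hF : (F : X →ₗ[ℂ] X) = J ∘ₗ S)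
    (hG : (G : X →ₗ[ℂ] X) = J ∘ₗ T) : detOneSub (F + G - F * G) = detOneSub F * detOneSub G := by
  have hcomp : ((F + G - F * G : X →L[ℂ] X) : X →ₗ[ℂ] X) = J ∘ₗ (S + T - S ∘ₗ J ∘ₗ T) := by
    rw [ContinuousLinearMap.toLinearMap_sub, ContinuousLinearMap.toLinearMap_add,
      ContinuousLinearMap.toLinearMap_mul, hF, hG, LinearMap.comp_sub, LinearMap.comp_add,
      End.mul_eq_comp, LinearMap.comp_assoc]
  have hfactor (A B : End ℂ V) : 1 - (A + B - A * B) = (1 - A) * (1 - B) := by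
    rw [sub_mul, one_mul, mul_sub, mul_one]
    abel
  rw [detOneSub_eq_of_eq_comp hcomp, detOneSub_eq_of_eq_comp hF, detOneSub_eq_of_eq_comp hG,
    ← map_mul]
  exact congrArg LinearMap.det (hfactor (S ∘ₗ J) (T ∘ₗ J))

theorem tr_eq_of_eq_comp (h : (F : X →ₗ[ℂ] X) = J ∘ₗ S) :
    tr F = LinearMap.trace ℂ V (S ∘ₗ J) := by
  have : FiniteDimensional ℂ (LinearMap.range (F : X →ₗ[ℂ] X)) := FiniteRank.of_eq_comp h
  obtain ⟨a, b, c, d, hab, hba, hdc⟩ := exists_onRange_eq_comp h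
  rw [tr, hab, hdc, LinearMap.trace_comp_comm', hba, LinearMap.trace_comp_comm']

theorem tr_pow_succ_eq_of_eq_comp (h : (F : X →ₗ[ℂ] X) = J ∘ₗ S) (k : ℕ) :
    tr (F ^ (k + 1)) = LinearMap.trace ℂ V ((S ∘ₗ J) ^ (k + 1)) := by
  have hpow : ((F ^ (k + 1) : X →L[ℂ] X) : X →ₗ[ℂ] X) = J ∘ₗ (((S ∘ₗ J) ^ k : End ℂ V) ∘ₗ S) := by
    induction k with
    | zero => rw [zero_add, pow_one, h]; rfl
    | succ k ih =>
      rw [pow_succ', ContinuousLinearMap.toLinearMap_mul, ih, h, pow_succ' (S ∘ₗ J)]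
      rfl
  rw [tr_eq_of_eq_comp hpow, pow_succ]
  rfl

theorem regDetFin_eq_of_eq_comp (p : ℝ) (h : (F : X →ₗ[ℂ] X) = J ∘ₗ S) :
    regDetFin p F = regDetEnd ⌈p⌉₊ (S ∘ₗ J) := by
  have htr : ∀ k ∈ Finset.Ico 1 ⌈p⌉₊, tr (F ^ k) = LinearMap.trace ℂ V ((S ∘ₗ J) ^ k) := by
    intro k hk
    obtain ⟨j, rfl⟩ := Nat.exists_eq_add_of_le' (Finset.mem_Ico.1 hk).1
    exact tr_pow_succ_eq_of_eq_comp h j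
  rw [regDetFin, regDetEnd, detOneSub_eq_of_eq_comp h,
    Finset.sum_congr rfl fun k hk => by rw [htr k hk]]

end Factorization

variable (X) in
/-- The space `𝓕(X)` of operators of finite rank. -/
def finiteRankOperators : Submodule ℂ (X →L[ℂ] X) where
  carrier := {F | FiniteRank F}
  zero_mem' := .of_range_le ⊥ (by simp)
  add_mem' {F G} hF hG := by
    obtain ⟨W, S, T, _, hS, hT⟩ := FiniteRank.exists_eq_subtype_comp hF hG
    exact .of_eq_comp (J := W.subtype) (S := S + T)
      (by rw [ContinuousLinearMap.toLinearMap_add, hS, hT, LinearMap.comp_add])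
  smul_mem' c F hF := by simpa using FiniteRank.mul_left hF (c • 1)

theorem FiniteRank.tr_mul_comm (hF : FiniteRank F) (B : X →L[ℂ] X) : tr (F * B) = tr (B * F) :=
  have : FiniteDimensional ℂ (LinearMap.range (F : X →ₗ[ℂ] X)) := hF
  let R := (LinearMap.range (F : X →ₗ[ℂ] X)).subtype
  let F' := (F : X →ₗ[ℂ] X).rangeRestrict
  (tr_eq_of_eq_comp (J := R) (S := F' ∘ₗ B) rfl).trans
    (tr_eq_of_eq_comp (J := B ∘ₗ R) (S := F') rfl).symm

theorem FiniteRank.regDetFin_mul_comm (hF : FiniteRank F) (p : ℝ) (B : X →L[ℂ] X) :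
    regDetFin p (F * B) = regDetFin p (B * F) :=
  have : FiniteDimensional ℂ (LinearMap.range (F : X →ₗ[ℂ] X)) := hF
  let R := (LinearMap.range (F : X →ₗ[ℂ] X)).subtype
  let F' := (F : X →ₗ[ℂ] X).rangeRestrict
  by rw [regDetFin_eq_of_eq_comp (F := F * B) (J := R) (S := F' ∘ₗ B) p rfl,
    regDetFin_eq_of_eq_comp (F := B * F) (J := B ∘ₗ R) (S := F') p rfl, LinearMap.comp_assoc]

theorem FiniteRank.tr_add (hF : FiniteRank F) (hG : FiniteRank G) : tr (F + G) = tr F + tr G := by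
  obtain ⟨W, S, T, _, hS, hT⟩ := hF.exists_eq_subtype_comp hG
  have hadd : ((F + G : X →L[ℂ] X) : X →ₗ[ℂ] X) = W.subtype ∘ₗ (S + T) := by
    rw [ContinuousLinearMap.toLinearMap_add, hS, hT, LinearMap.comp_add]
  rw [tr_eq_of_eq_comp hadd, tr_eq_of_eq_comp hS, tr_eq_of_eq_comp hT, LinearMap.add_comp, map_add]

variable (X) in
/-- The trace as an additive map on `𝓕(X)`. -/
def trAddHom : finiteRankOperators X →+ ℂ :=
  AddMonoidHom.mk' (fun F => tr (F : X →L[ℂ] X)) fun F G => FiniteRank.tr_add F.2 G.2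

theorem tr_sum {ι : Type*} (s : Finset ι) {f : ι → X →L[ℂ] X} (hf : ∀ i, FiniteRank (f i)) :
    tr (∑ i ∈ s, f i) = ∑ i ∈ s, tr (f i) := by
  have hsum := map_sum (trAddHom X) (fun i => (⟨f i, hf i⟩ : finiteRankOperators X)) s
  simpa only [trAddHom, AddMonoidHom.mk'_apply, AddSubmonoidClass.coe_finsetSum] using hsum

theorem FiniteRank.detOneSub_mul (hF : FiniteRank F) (hG : FiniteRank G) :
    detOneSub (F + G - F * G) = detOneSub F * detOneSub G := by
  obtain ⟨W, S, T, _, hS, hT⟩ := hF.exists_eq_subtype_comp hG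
  exact detOneSub_mul_of_eq_comp hS hT

theorem FiniteRank.differentiable_regDetFin_add_smul (hF : FiniteRank F) (hG : FiniteRank G)
    (p : ℝ) : Differentiable ℂ fun z : ℂ => regDetFin p (F + z • G) := by
  obtain ⟨W, S, T, _, hS, hT⟩ := hF.exists_eq_subtype_comp hG
  have hcomp (z : ℂ) : ((F + z • G : X →L[ℂ] X) : X →ₗ[ℂ] X) = W.subtype ∘ₗ (S + z • T) := by
    rw [ContinuousLinearMap.toLinearMap_add, ContinuousLinearMap.toLinearMap_smul, hS, hT,
      LinearMap.comp_add, LinearMap.comp_smul]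
  simp only [regDetFin_eq_of_eq_comp p (hcomp _), LinearMap.add_comp, LinearMap.smul_comp]
  exact differentiable_regDetEnd_add_smul _ _ _

theorem FiniteRank.continuous_tr_mul (hF : FiniteRank F) :
    Continuous fun A : X →L[ℂ] X => tr (F * A) := by
  have : FiniteDimensional ℂ (LinearMap.range (F : X →ₗ[ℂ] X)) := hF
  let R := LinearMap.range (F : X →ₗ[ℂ] X)
  let F' : X →L[ℂ] R := F.codRestrict R fun x => ⟨x, rfl⟩
  let trace : (R →L[ℂ] R) →ₗ[ℂ] ℂ := LinearMap.trace ℂ R ∘ₗ ContinuousLinearMap.coeLM ℂ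
  have htrace : Continuous trace := trace.continuous_of_finiteDimensional
  have htr (A : X →L[ℂ] X) : tr (F * A) = trace (F' ∘L A ∘L R.subtypeL) :=
    tr_eq_of_eq_comp (J := R.subtype) (S := (F : X →ₗ[ℂ] X).rangeRestrict ∘ₗ A) rfl
  simp only [htr]
  fun_prop

theorem FiniteRank.mem_spectrum_iff (hF : FiniteRank F) {z : ℂ} (hz : z ≠ 0) :
    z ∈ spectrum ℂ F ↔ z ∈ spectrum ℂ (onRange F) := by
  have : FiniteDimensional ℂ (LinearMap.range (F : X →ₗ[ℂ] X)) := hF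
  let R := LinearMap.range (F : X →ₗ[ℂ] X)
  let F' : X →L[ℂ] R := F.codRestrict R fun x => ⟨x, rfl⟩
  rw [← AlgEquiv.spectrum_eq (Module.End.toContinuousLinearMap R) (onRange F)]
  exact mem_spectrum_comp_comm (f := F') (g := R.subtypeL) hz

theorem FiniteRank.isUnit_one_sub_iff (hF : FiniteRank F) :
    IsUnit (1 - F) ↔ detOneSub F ≠ 0 := by
  have : FiniteDimensional ℂ (LinearMap.range (F : X →ₗ[ℂ] X)) := hF
  have hspectrum := (hF.mem_spectrum_iff one_ne_zero).not
  rwa [spectrum.notMem_iff, spectrum.notMem_iff, map_one, map_one,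
    LinearMap.isUnit_iff_isUnit_det, isUnit_iff_ne_zero] at hspectrum

end

/-! ### Riesz projections and discrete eigenvalues -/

section

open Module Metric

section CircleIntegral

variable {E F : Type*} [NormedAddCommGroup E] [NormedSpace ℂ E] [CompleteSpace E]
  [NormedAddCommGroup F] [NormedSpace ℂ F] [CompleteSpace F] {f : ℂ → E} {c : ℂ} {R : ℝ}

theorem circleIntegral_comp_comm (L : E →L[ℂ] F) (hf : CircleIntegrable f c R) :
    ∮ z in C(c, R), L (f z) = L (∮ z in C(c, R), f z) := by
  simp only [circleIntegral, ← map_smul]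
  exact L.intervalIntegral_comp_comm hf.out

theorem circleIntegral_zpow_neg_succ (k : ℕ) (hR : R ≠ 0) :
    ∮ z in C(c, R), (z - c) ^ (-(k + 1 : ℤ)) = if k = 0 then 2 * Real.pi * Complex.I else 0 := by
  split_ifs with hk
  · simpa [hk] using circleIntegral.integral_sub_center_inv c hR
  · exact circleIntegral.integral_sub_zpow_of_ne (by omega) c c R

end CircleIntegral

variable {X : Type*} [NormedAddCommGroup X] [NormedSpace ℂ X]

section Resolvent

variable {Z : X →L[ℂ] X} {z μ : ℂ} {r : ℝ}

theorem resolvent_apply_of_sub_apply_eq (hμ : μ ∈ resolventSet ℂ Z) {x y : X}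
    (h : μ • y - Z y = x) : resolvent Z μ x = y := by
  have hinv : resolvent Z μ * (algebraMap ℂ (X →L[ℂ] X) μ - Z) = 1 := Ring.inverse_mul_cancel _ hμ
  rw [← h]
  simpa [Algebra.algebraMap_eq_smul_one] using DFunLike.congr_fun hinv y

theorem resolvent_apply_eq_sum_of_pow_eq_zero (hμ : μ ∈ resolventSet ℂ Z) (hne : μ ≠ z) {n : ℕ}
    {x : X} (hx : ((Z - z • 1) ^ n : X →L[ℂ] X) x = 0) :
    resolvent Z μ x =
      ∑ k ∈ Finset.range n, (μ - z) ^ (-(k + 1 : ℤ)) • ((Z - z • 1) ^ k : X →L[ℂ] X) x := by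
  refine resolvent_apply_of_sub_apply_eq hμ ?_
  set T := Z - z • 1 with hT
  set u : ℕ → X := fun k => (μ - z) ^ (-k : ℤ) • (T ^ k) x with hu
  have hsub (y : X) : μ • y - Z y = (μ - z) • y - T y := by
    simp only [hT, sub_apply, smul_apply, one_apply_eq_self]
    module
  have hterm (k : ℕ) : (μ - z) • (μ - z) ^ (-(k + 1 : ℤ)) • (T ^ k) x -
      T ((μ - z) ^ (-(k + 1 : ℤ)) • (T ^ k) x) = u k - u (k + 1) := by
    simp only [hu, smul_smul, map_smul, pow_succ' T, mul_apply_eq_comp, Nat.cast_succ]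
    rw [← zpow_one_add₀ (sub_ne_zero.2 hne)]
    simp
  rw [hsub, Finset.smul_sum, map_sum, ← Finset.sum_sub_distrib, Finset.sum_congr rfl fun k _ =>
    hterm k, Finset.sum_range_sub']
  simp only [hu, hx, smul_zero, sub_zero, CharP.cast_eq_zero, neg_zero, zpow_zero, pow_zero,
    one_apply_eq_self, one_smul]

theorem resolvent_eq_inv_smul_add (hμ : μ ∈ resolventSet ℂ Z) (h0 : μ ≠ 0) :
    resolvent Z μ = μ⁻¹ • 1 + Z * μ⁻¹ • resolvent Z μ := by
  have hinv : (algebraMap ℂ (X →L[ℂ] X) μ - Z) * resolvent Z μ = 1 := Ring.mul_inverse_cancel _ hμ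
  rw [sub_mul, Algebra.algebraMap_eq_smul_one, smul_mul_assoc, one_mul, sub_eq_iff_eq_add] at hinv
  rw [mul_smul_comm, ← smul_add, ← hinv, inv_smul_smul₀ h0]

theorem IsIsolatingRadius.mem_resolventSet (h : IsIsolatingRadius Z z r) (hμ : μ ∈ sphere z r) :
    μ ∈ resolventSet ℂ Z := by
  by_contra hmem
  exact ne_of_mem_sphere hμ h.1.ne' (h.2 ⟨hmem, sphere_subset_closedBall hμ⟩)

variable [CompleteSpace X]

theorem IsIsolatingRadius.continuousOn_resolvent (h : IsIsolatingRadius Z z r) :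
    ContinuousOn (resolvent Z) (sphere z r) := fun _ hμ =>
  (spectrum.hasDerivAt_resolvent_const_left
    (h.mem_resolventSet hμ)).continuousAt.continuousWithinAt

theorem IsIsolatingRadius.circleIntegral_resolvent_apply (h : IsIsolatingRadius Z z r) {n : ℕ}
    {x : X} (hx : ((Z - z • 1) ^ n : X →L[ℂ] X) x = 0) :
    (∮ μ in C(z, r), resolvent Z μ) x = (2 * Real.pi * Complex.I : ℂ) • x := by
  have hx' : ((Z - z • 1) ^ (n + 1) : X →L[ℂ] X) x = 0 := by
    rw [pow_succ', mul_apply_eq_comp, hx, map_zero]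
  have hsum : Set.EqOn (fun μ => resolvent Z μ x)
      (fun μ => ∑ k ∈ Finset.range (n + 1),
        (μ - z) ^ (-(k + 1 : ℤ)) • ((Z - z • 1) ^ k : X →L[ℂ] X) x) (sphere z r) := fun μ hμ =>
    resolvent_apply_eq_sum_of_pow_eq_zero (h.mem_resolventSet hμ) (ne_of_mem_sphere hμ h.1.ne') hx'
  have hint (k : ℕ) : CircleIntegrable
      (fun μ => (μ - z) ^ (-(k + 1 : ℤ)) • ((Z - z • 1) ^ k : X →L[ℂ] X) x) z r :=
    .smul_continuousOn (circleIntegrable_sub_zpow_iff.2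
      (.inr (.inr fun hz => ne_of_mem_sphere hz (abs_pos.2 h.1.ne').ne' rfl))) continuousOn_const
  have heval := circleIntegral_comp_comm (ContinuousLinearMap.apply ℂ X x)
    (h.continuousOn_resolvent.circleIntegrable h.1.le)
  simp only [ContinuousLinearMap.apply_apply] at heval
  rw [← heval, circleIntegral.integral_congr h.1.le hsum,
    circleIntegral.integral_fun_sum fun k _ => hint k]
  simp only [circleIntegral.integral_smul_const, circleIntegral_zpow_neg_succ _ h.1.ne']
  simp

theorem rieszProjection_apply_of_mem_maxGenEigenspace (h : ∃ r, IsIsolatingRadius Z z r) {x : X}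
    (hx : x ∈ End.maxGenEigenspace (Z : X →ₗ[ℂ] X) z) : rieszProjection Z z x = x := by
  obtain ⟨n, hn⟩ := (End.mem_maxGenEigenspace _ _ _).1 hx
  have hpow : (((Z - z • 1) ^ n : X →L[ℂ] X) : X →ₗ[ℂ] X) = ((Z : X →ₗ[ℂ] X) - z • 1) ^ n :=
    ContinuousLinearMap.toLinearMap_pow _ n
  have hZx : ((Z - z • 1) ^ n : X →L[ℂ] X) x = 0 := (LinearMap.congr_fun hpow x).trans hn
  rw [rieszProjection, dif_pos h, smul_apply, h.choose_spec.circleIntegral_resolvent_apply hZx,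
    inv_smul_smul₀ Complex.two_pi_I_ne_zero]

/-- Since `(μ - Z)⁻¹ = μ⁻¹ (1 + Z (μ - Z)⁻¹)` and `μ⁻¹` is holomorphic on the disc, a factor `Z`
can be taken out of the integral. -/
theorem IsIsolatingRadius.circleIntegral_resolvent_eq_mul (h : IsIsolatingRadius Z z r)
    (h0 : (0 : ℂ) ∉ closedBall z r) :
    ∮ μ in C(z, r), resolvent Z μ = Z * ∮ μ in C(z, r), μ⁻¹ • resolvent Z μ := by
  have hne : ∀ μ ∈ closedBall z r, μ ≠ 0 := fun μ hμ hμ0 => h0 (hμ0 ▸ hμ)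
  have hinv : ∮ μ in C(z, r), μ⁻¹ = 0 :=
    (differentiableOn_inv.diffContOnCl_ball hne).circleIntegral_eq_zero h.1.le
  have hinv_cont : ContinuousOn (fun μ : ℂ => μ⁻¹) (sphere z r) :=
    continuousOn_inv₀.mono fun μ hμ => hne μ (sphere_subset_closedBall hμ)
  have hcont : ContinuousOn (fun μ => μ⁻¹ • resolvent Z μ) (sphere z r) :=
    hinv_cont.smul h.continuousOn_resolvent
  have hmul : ∮ μ in C(z, r), Z * μ⁻¹ • resolvent Z μ = Z * ∮ μ in C(z, r), μ⁻¹ • resolvent Z μ :=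
    circleIntegral_comp_comm (ContinuousLinearMap.mul ℂ (X →L[ℂ] X) Z)
      (hcont.circleIntegrable h.1.le)
  have hint₁ : CircleIntegrable (fun μ : ℂ => μ⁻¹ • (1 : X →L[ℂ] X)) z r :=
    (hinv_cont.smul continuousOn_const).circleIntegrable h.1.le
  have hint₂ : CircleIntegrable (fun μ => Z * μ⁻¹ • resolvent Z μ) z r :=
    (continuousOn_const.mul hcont).circleIntegrable h.1.le
  rw [circleIntegral.integral_congr h.1.le fun μ hμ => resolvent_eq_inv_smul_add
      (h.mem_resolventSet hμ) (hne μ (sphere_subset_closedBall hμ)),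
    circleIntegral.integral_add hint₁ hint₂, circleIntegral.integral_smul_const, hinv, zero_smul,
    zero_add, hmul]

theorem exists_rieszProjection_eq_mul (Z : X →L[ℂ] X) (hz : z ≠ 0) :
    ∃ A, rieszProjection Z z = Z * A := by
  by_cases h : ∃ r, IsIsolatingRadius Z z r
  swap
  · exact ⟨0, by rw [rieszProjection, dif_neg h, mul_zero]⟩
  by_cases hZ : IsUnit Z
  · exact ⟨Ring.inverse Z * rieszProjection Z z, (Ring.mul_inverse_cancel_left Z _ hZ).symm⟩
  have h0 : (0 : ℂ) ∉ closedBall z h.choose := fun hmem =>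
    hz (h.choose_spec.2 ⟨(spectrum.zero_mem_iff ℂ).2 hZ, hmem⟩).symm
  exact ⟨_, by rw [rieszProjection, dif_pos h,
    h.choose_spec.circleIntegral_resolvent_eq_mul h0, ← mul_smul_comm]⟩

end Resolvent

section Eigenvalues

variable {F : X →L[ℂ] X} {z : ℂ} {p : ℝ}

theorem FiniteRank.exists_isIsolatingRadius (hF : FiniteRank F) (z : ℂ) :
    ∃ r, IsIsolatingRadius F z r := by
  have : FiniteDimensional ℂ (LinearMap.range (F : X →ₗ[ℂ] X)) := hF
  have hsub : spectrum ℂ F ⊆ insert 0 (spectrum ℂ (onRange F)) := fun μ hμ =>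
    or_iff_not_imp_left.2 fun h0 => (hF.mem_spectrum_iff h0).1 hμ
  have hfin : (spectrum ℂ F \ {z}).Finite :=
    (((End.finite_spectrum (onRange F)).insert 0).subset hsub).sdiff
  obtain ⟨r, hr, hball⟩ := nhds_basis_closedBall.mem_iff.1
    (hfin.isClosed.isOpen_compl.mem_nhds (show z ∈ (spectrum ℂ F \ {z})ᶜ by simp))
  exact ⟨r, hr, fun μ hμ => by_contra fun hne => hball hμ.2 ⟨hμ.1, hne⟩⟩

theorem map_maxGenEigenspace_onRange_le (F : X →L[ℂ] X) (z : ℂ) :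
    (End.maxGenEigenspace (onRange F) z).map (LinearMap.range (F : X →ₗ[ℂ] X)).subtype ≤
      End.maxGenEigenspace (F : X →ₗ[ℂ] X) z := by
  rintro _ ⟨x, hx, rfl⟩
  obtain ⟨n, hn⟩ := (End.mem_maxGenEigenspace _ _ _).1 hx
  refine (End.mem_maxGenEigenspace _ _ _).2 ⟨n, ?_⟩
  have hsemiconj : ((F : X →ₗ[ℂ] X) - z • 1) ∘ₗ (LinearMap.range (F : X →ₗ[ℂ] X)).subtype =
      (LinearMap.range (F : X →ₗ[ℂ] X)).subtype ∘ₗ (onRange F - z • 1) := rfl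
  have hpow := LinearMap.congr_fun (End.commute_pow_left_of_commute hsemiconj n) x
  exact hpow.trans (congrArg Subtype.val hn)

theorem hasEigenvalue_of_hasEigenvalue_onRange (h : End.HasEigenvalue (onRange F) z) :
    End.HasEigenvalue (F : X →ₗ[ℂ] X) z := by
  obtain ⟨v, hv⟩ := h.exists_hasEigenvector
  exact End.hasEigenvalue_of_hasEigenvector (x := (v : X))
    ⟨End.mem_eigenspace_iff.2 (congrArg Subtype.val hv.apply_eq_smul),
      fun h0 => hv.2 (Subtype.ext h0)⟩

variable [CompleteSpace X]

theorem FiniteRank.rieszProjection (hF : FiniteRank F) (hz : z ≠ 0) :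
    FiniteRank (rieszProjection F z) := by
  obtain ⟨A, hA⟩ := exists_rieszProjection_eq_mul F hz
  exact hA ▸ hF.mul_right A

variable [FiniteDimensional ℂ (LinearMap.range (F : X →ₗ[ℂ] X))]

theorem rootMultiplicity_le_algMult (hz : z ≠ 0) :
    (onRange F).charpoly.rootMultiplicity z ≤ algMult F z := by
  have hF : FiniteRank F := ‹_›
  have : FiniteDimensional ℂ (LinearMap.range (RegDet.rieszProjection F z : X →ₗ[ℂ] X)) :=
    hF.rieszProjection hz
  rw [← LinearMap.finrank_maxGenEigenspace_eq, algMult,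
    (Submodule.equivMapOfInjective (LinearMap.range (F : X →ₗ[ℂ] X)).subtype
      Subtype.val_injective (End.maxGenEigenspace (onRange F) z)).finrank_eq]
  exact Submodule.finrank_mono fun x hx => ⟨x, rieszProjection_apply_of_mem_maxGenEigenspace
    (hF.exists_isIsolatingRadius z) (map_maxGenEigenspace_onRange_le F z hx)⟩

theorem mem_discreteSpectrum_of_mem_roots (hz : z ≠ 0)
    (h : z ∈ (onRange F).charpoly.roots) : z ∈ discreteSpectrum F := by
  have hF : FiniteRank F := ‹_›
  exact ⟨hasEigenvalue_of_hasEigenvalue_onRange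
    ((End.hasEigenvalue_iff_isRoot_charpoly _ _).2 (Polynomial.isRoot_of_mem_roots h)),
    hF.exists_isIsolatingRadius z, hF.rieszProjection hz⟩

open scoped ENNReal in
theorem ofReal_sum_roots_rpow_le (hp : p ≠ 0) :
    ENNReal.ofReal ((onRange F).charpoly.roots.map (‖·‖ ^ p)).sum ≤
      ∑' z : discreteSpectrum F, (algMult F z : ℝ≥0∞) * ENNReal.ofReal (‖(z : ℂ)‖ ^ p) := by
  classical
  set roots := (onRange F).charpoly.roots with hroots
  set weight : ℂ → ℝ≥0∞ := fun z => algMult F z * ENNReal.ofReal (‖z‖ ^ p)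
  have hweight : ∀ z ∈ roots.toFinset, ENNReal.ofReal (roots.count z • ‖z‖ ^ p) ≤
      (discreteSpectrum F).indicator weight z := by
    intro z hz
    rcases eq_or_ne z 0 with rfl | h0
    · simp [Real.zero_rpow hp]
    rw [Set.indicator_of_mem (mem_discreteSpectrum_of_mem_roots h0 (Multiset.mem_toFinset.1 hz)),
      ENNReal.ofReal_nsmul, nsmul_eq_mul, hroots, Polynomial.count_roots]
    exact mul_le_mul_left (Nat.cast_le.2 (rootMultiplicity_le_algMult h0)) _
  calc ENNReal.ofReal (roots.map (‖·‖ ^ p)).sum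
      = ∑ z ∈ roots.toFinset, ENNReal.ofReal (roots.count z • ‖z‖ ^ p) := by
        rw [Finset.sum_multiset_map_count, ENNReal.ofReal_sum_of_nonneg fun _ _ => by positivity]
    _ ≤ ∑ z ∈ roots.toFinset, (discreteSpectrum F).indicator weight z := Finset.sum_le_sum hweight
    _ ≤ ∑' z, (discreteSpectrum F).indicator weight z := ENNReal.sum_le_tsum _
    _ = ∑' z : discreteSpectrum F, weight z := (tsum_subtype _ _).symm

theorem sum_roots_rpow_le (hp : 0 < p) {C : ℝ} (hC : 0 ≤ C)
    (h : eigenvalueLpNorm p F ≤ ENNReal.ofReal C) :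
    ((onRange F).charpoly.roots.map (‖·‖ ^ p)).sum ≤ C ^ p := by
  rw [eigenvalueLpNorm, one_div, ENNReal.rpow_inv_le_iff hp,
    ENNReal.ofReal_rpow_of_nonneg hC hp.le] at h
  exact (ENNReal.ofReal_le_ofReal_iff (by positivity)).1
    ((ofReal_sum_roots_rpow_le hp.ne').trans h)

end Eigenvalues

end

/-! ### Bounds for regularized determinants -/

section

open Module

section ElementaryFactor

variable {p : ℝ} {z : ℂ}

theorem elemFactor_eq_exp (m : ℕ) (hz : ‖z‖ < 1) :
    elemFactor m z = Complex.exp (Complex.log (1 + -z) - Complex.logTaylor m (-z)) := by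
  have hne : 1 + -z ≠ 0 := by
    rw [← sub_eq_add_neg, sub_ne_zero]
    rintro rfl
    simp at hz
  have hterm (k : ℕ) : -((-1) ^ (k + 1) * (-z) ^ k / k) = z ^ k / k := by
    rw [neg_pow z, ← mul_assoc, ← pow_add, Odd.neg_one_pow ⟨k, by ring⟩]
    ring
  have hsum : ∑ k ∈ Finset.Ico 1 m, z ^ k / (k : ℂ) = -Complex.logTaylor m (-z) := by
    simp only [Complex.logTaylor, ← Finset.sum_neg_distrib, hterm]
    refine Finset.sum_subset (fun k hk => Finset.mem_range.2 (Finset.mem_Ico.1 hk).2)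
      fun k hk hk' => ?_
    obtain rfl : k = 0 := by grind
    simp
  rw [elemFactor, hsum, sub_eq_add_neg (Complex.log _), Complex.exp_add, Complex.exp_log hne,
    sub_eq_add_neg 1]

theorem norm_log_sub_logTaylor_le_rpow (hp : 0 < p) (hz : ‖z‖ ≤ 1 / 2) :
    ‖Complex.log (1 + -z) - Complex.logTaylor ⌈p⌉₊ (-z)‖ ≤ 2 * ‖z‖ ^ p := by
  obtain ⟨n, hn⟩ := Nat.exists_eq_succ_of_ne_zero (Nat.ceil_pos.2 hp).ne'
  have hz1 : ‖z‖ < 1 := by linarith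
  have hinv : (1 - ‖z‖)⁻¹ ≤ 2 := inv_le_of_inv_le₀ two_pos (by linarith)
  have hpow : ‖z‖ ^ (n + 1) ≤ ‖z‖ ^ p := by
    rw [← Real.rpow_natCast]
    exact Real.rpow_le_rpow_of_exponent_ge' (norm_nonneg z) hz1.le hp.le (Nat.ceil_le.1 hn.le)
  calc ‖Complex.log (1 + -z) - Complex.logTaylor ⌈p⌉₊ (-z)‖
      ≤ ‖z‖ ^ (n + 1) * (1 - ‖z‖)⁻¹ / (n + 1) := by
        simpa only [hn, norm_neg] using
          Complex.norm_log_sub_logTaylor_le n ((norm_neg z).trans_lt hz1)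
    _ ≤ ‖z‖ ^ (n + 1) * (1 - ‖z‖)⁻¹ :=
        div_le_self (mul_nonneg (by positivity) (inv_nonneg.2 (by linarith))) (by simp)
    _ ≤ ‖z‖ ^ p * 2 := by gcongr
    _ = 2 * ‖z‖ ^ p := mul_comm _ _

theorem exp_neg_le_norm_elemFactor (hp : 0 < p) (hz : ‖z‖ ≤ 1 / 2) :
    Real.exp (-2 * ‖z‖ ^ p) ≤ ‖elemFactor ⌈p⌉₊ z‖ := by
  rw [elemFactor_eq_exp _ (by linarith), Complex.norm_exp, Real.exp_le_exp, neg_mul]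
  exact (neg_le_neg (norm_log_sub_logTaylor_le_rpow hp hz)).trans
    (neg_le_of_abs_le (Complex.abs_re_le_norm _))

theorem norm_elemFactor_le_of_norm_le (hp : 0 < p) (hz : ‖z‖ ≤ 1 / 2) :
    ‖elemFactor ⌈p⌉₊ z‖ ≤ Real.exp (2 * ‖z‖ ^ p) := by
  rw [elemFactor_eq_exp _ (by linarith), Complex.norm_exp, Real.exp_le_exp]
  exact (Complex.re_le_norm _).trans (norm_log_sub_logTaylor_le_rpow hp hz)

theorem norm_one_sub_le_exp (hp : 0 < p) {t : ℝ} (ht : 1 ≤ t) (hz : ‖z‖ ≤ t) :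
    ‖1 - z‖ ≤ Real.exp ((1 + 1 / p) * t ^ p) := by
  have ht0 : 0 < t := by linarith
  calc ‖1 - z‖ ≤ 1 + ‖z‖ := by simpa using norm_sub_le (1 : ℂ) z
    _ ≤ (1 + 1) * t := by linarith
    _ ≤ (t ^ p + 1) * t := by gcongr; exact Real.one_le_rpow ht hp.le
    _ ≤ Real.exp (t ^ p) * Real.exp (Real.log t) := by
        rw [Real.exp_log ht0]
        gcongr
        exact Real.add_one_le_exp _
    _ ≤ Real.exp (t ^ p) * Real.exp (t ^ p / p) := by
        gcongr
        exact Real.log_le_rpow_div ht0.le hp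
    _ = Real.exp ((1 + 1 / p) * t ^ p) := by rw [← Real.exp_add]; ring_nf

theorem norm_sum_pow_div_le {t : ℝ} (ht : 1 ≤ t) (hz : ‖z‖ ≤ t) :
    ‖∑ k ∈ Finset.Ico 1 ⌈p⌉₊, z ^ k / (k : ℂ)‖ ≤ ⌈p⌉₊ * t ^ p := by
  have hterm : ∀ k ∈ Finset.Ico 1 ⌈p⌉₊, ‖z ^ k / (k : ℂ)‖ ≤ t ^ p := fun k hk => by
    obtain ⟨hk1, hkp⟩ := Finset.mem_Ico.1 hk
    rw [norm_div, norm_pow, Complex.norm_natCast]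
    calc ‖z‖ ^ k / k ≤ ‖z‖ ^ k := div_le_self (by positivity) (by exact_mod_cast hk1)
      _ ≤ t ^ k := by gcongr
      _ = t ^ (k : ℝ) := (Real.rpow_natCast _ _).symm
      _ ≤ t ^ p := Real.rpow_le_rpow_of_exponent_le ht (Nat.lt_ceil.1 hkp).le
  refine (norm_sum_le_of_le _ hterm).trans ?_
  rw [Finset.sum_const, Nat.card_Ico, nsmul_eq_mul]
  gcongr
  exact Nat.sub_le _ _

theorem norm_elemFactor_le_of_le_norm (hp : 0 < p) (hz : 1 / 2 ≤ ‖z‖) :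
    ‖elemFactor ⌈p⌉₊ z‖ ≤ Real.exp ((1 + 1 / p + ⌈p⌉₊) * 2 ^ p * ‖z‖ ^ p) := by
  have ht : 1 ≤ 2 * ‖z‖ := by linarith
  have hzt : ‖z‖ ≤ 2 * ‖z‖ := by linarith
  rw [elemFactor, norm_mul, Complex.norm_exp, mul_assoc,
    ← Real.mul_rpow two_pos.le (norm_nonneg z), add_mul, Real.exp_add]
  gcongr
  · exact norm_one_sub_le_exp hp ht hzt
  · exact (Complex.re_le_norm _).trans (norm_sum_pow_div_le ht hzt)

theorem exists_norm_elemFactor_le (hp : 0 < p) :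
    ∃ C : ℝ, 0 ≤ C ∧ ∀ z : ℂ, ‖elemFactor ⌈p⌉₊ z‖ ≤ Real.exp (C * ‖z‖ ^ p) := by
  refine ⟨max 2 ((1 + 1 / p + ⌈p⌉₊) * 2 ^ p), le_max_of_le_left two_pos.le, fun z => ?_⟩
  rcases le_total ‖z‖ (1 / 2) with hz | hz
  · refine (norm_elemFactor_le_of_norm_le hp hz).trans ?_
    gcongr
    exact le_max_left _ _
  · refine (norm_elemFactor_le_of_le_norm hp hz).trans ?_
    gcongr
    exact le_max_right _ _

end ElementaryFactor

section MultisetProd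

variable {ι 𝕜 : Type*} [NormedField 𝕜] {s : Multiset ι} {f : ι → 𝕜} {g : ι → ℝ}

theorem norm_prod_map (s : Multiset ι) (f : ι → 𝕜) : ‖(s.map f).prod‖ = (s.map (‖f ·‖)).prod :=
  (map_multiset_prod (normHom (α := 𝕜)) _).trans (congrArg _ (Multiset.map_map _ _ _))

theorem norm_prod_map_le_exp_sum (h : ∀ i ∈ s, ‖f i‖ ≤ Real.exp (g i)) :
    ‖(s.map f).prod‖ ≤ Real.exp (s.map g).sum := by
  rw [norm_prod_map, Real.exp_multiset_sum, Multiset.map_map]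
  exact Multiset.prod_map_le_prod_map₀ _ _ (fun _ _ => norm_nonneg _) h

theorem exp_sum_le_norm_prod_map (h : ∀ i ∈ s, Real.exp (g i) ≤ ‖f i‖) :
    Real.exp (s.map g).sum ≤ ‖(s.map f).prod‖ := by
  rw [norm_prod_map, Real.exp_multiset_sum, Multiset.map_map]
  exact Multiset.prod_map_le_prod_map₀ _ _ (fun _ _ => (Real.exp_pos _).le) h

end MultisetProd

section FiniteRank

variable {X : Type*} [NormedAddCommGroup X] [NormedSpace ℂ X] {F : X →L[ℂ] X} {p : ℝ}

theorem norm_le_opNorm_of_hasEigenvalue {z : ℂ} (hz : End.HasEigenvalue (F : X →ₗ[ℂ] X) z) :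
    ‖z‖ ≤ ‖F‖ := by
  obtain ⟨v, hv⟩ := hz.exists_hasEigenvector
  have hle : ‖z • v‖ ≤ ‖F‖ * ‖v‖ := hv.apply_eq_smul ▸ F.le_opNorm v
  exact le_of_mul_le_mul_right ((norm_smul z v).symm.trans_le hle) (norm_pos_iff.2 hv.2)

theorem norm_le_opNorm_of_mem_roots [FiniteDimensional ℂ (LinearMap.range (F : X →ₗ[ℂ] X))] {z : ℂ}
    (hz : z ∈ (onRange F).charpoly.roots) : ‖z‖ ≤ ‖F‖ :=
  norm_le_opNorm_of_hasEigenvalue (hasEigenvalue_of_hasEigenvalue_onRange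
    ((End.hasEigenvalue_iff_isRoot_charpoly _ _).2 (Polynomial.isRoot_of_mem_roots hz)))

theorem regDetFin_eq_prod_roots [FiniteDimensional ℂ (LinearMap.range (F : X →ₗ[ℂ] X))] :
    regDetFin p F = ((onRange F).charpoly.roots.map (elemFactor ⌈p⌉₊)).prod :=
  (regDetFin_eq_of_eq_comp p (J := (LinearMap.range (F : X →ₗ[ℂ] X)).subtype)
    (S := (F : X →ₗ[ℂ] X).rangeRestrict) rfl).trans (regDetEnd_eq_prod_roots_charpoly _ _)

variable [CompleteSpace X]

variable (X) in
theorem exists_norm_regDetFin_le (hp : 0 < p) :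
    ∃ C : ℝ, 0 ≤ C ∧ ∀ F : X →L[ℂ] X, FiniteRank F → ∀ M : ℝ, 0 ≤ M →
      eigenvalueLpNorm p F ≤ ENNReal.ofReal M → ‖regDetFin p F‖ ≤ Real.exp (C * M ^ p) := by
  obtain ⟨C, hC, hfactor⟩ := exists_norm_elemFactor_le hp
  refine ⟨C, hC, fun F hF M hM hFM => ?_⟩
  have : FiniteDimensional ℂ (LinearMap.range (F : X →ₗ[ℂ] X)) := hF
  calc ‖regDetFin p F‖ = ‖((onRange F).charpoly.roots.map (elemFactor ⌈p⌉₊)).prod‖ :=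
        by rw [regDetFin_eq_prod_roots]
    _ ≤ Real.exp ((onRange F).charpoly.roots.map (C * ‖·‖ ^ p)).sum :=
        norm_prod_map_le_exp_sum fun z _ => hfactor z
    _ ≤ Real.exp (C * M ^ p) := by
        rw [Multiset.sum_map_mul_left]
        gcongr
        exact sum_roots_rpow_le hp hM hFM

theorem FiniteRank.exp_neg_le_norm_regDetFin (hF : FiniteRank F) (hp : 0 < p)
    (hF2 : ‖F‖ ≤ 1 / 2) {M : ℝ} (hM : 0 ≤ M) (hFM : eigenvalueLpNorm p F ≤ ENNReal.ofReal M) :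
    Real.exp (-2 * M ^ p) ≤ ‖regDetFin p F‖ := by
  have : FiniteDimensional ℂ (LinearMap.range (F : X →ₗ[ℂ] X)) := hF
  calc Real.exp (-2 * M ^ p)
      ≤ Real.exp ((onRange F).charpoly.roots.map (-2 * ‖·‖ ^ p)).sum := by
        rw [Multiset.sum_map_mul_left, Real.exp_le_exp]
        exact mul_le_mul_of_nonpos_left (sum_roots_rpow_le hp hM hFM) (by norm_num)
    _ ≤ ‖((onRange F).charpoly.roots.map (elemFactor ⌈p⌉₊)).prod‖ :=
        exp_sum_le_norm_prod_map fun z hz =>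
          exp_neg_le_norm_elemFactor hp ((norm_le_opNorm_of_mem_roots hz).trans hF2)
    _ = ‖regDetFin p F‖ := by rw [regDetFin_eq_prod_roots]

end FiniteRank

end

/-! ### Quasi-norms and extension by continuity -/

section Extension

open Filter Topology Uniformity

variable {α β : Type*} [UniformSpace α] [UniformSpace β] [CompleteSpace β] [T0Space β] {s : Set α}
  {f : α → β}

theorem exists_continuous_eqOn_of_dense (hs : Dense s)
    (hf : ∀ x, ∃ U ∈ 𝓝 x, UniformContinuousOn f (U ∩ s)) :
    ∃ g : α → β, Continuous g ∧ Set.EqOn g f s := by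
  have hlim : ∀ x, ∃ y, Tendsto f (𝓝[s] x) (𝓝 y) := fun x => by
    obtain ⟨U, hU, hfU⟩ := hf x
    have : (𝓝[s] x).NeBot := mem_closure_iff_nhdsWithin_neBot.1 (hs x)
    have hle : 𝓝[s] x ≤ 𝓟 (U ∩ s) :=
      le_principal_iff.2 (inter_mem (mem_nhdsWithin_of_mem_nhds hU) self_mem_nhdsWithin)
    exact CompleteSpace.complete ((cauchy_nhds.mono nhdsWithin_le_nhds).map_of_le hfU hle)
  refine ⟨extendFrom s f, continuous_extendFrom hs hlim, fun x hx => ?_⟩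
  obtain ⟨y, hy⟩ := hlim x
  rw [extendFrom_eq (hs x) hy]
  exact tendsto_nhds_unique (hy.mono_left (pure_le_nhdsWithin hx)) (tendsto_pure_nhds f x)

end Extension

section QuasiNorm

open Filter Topology Uniformity

variable {V : Type*} [AddCommGroup V] [Module ℂ V] {N : V → ℝ} {D E : V → ℂ} {S : Set V}

theorem IsQuasiNorm.map_zero (h : IsQuasiNorm N) : N 0 = 0 := (h.eq_zero_iff 0).2 rfl

theorem IsQuasiNorm.map_neg (h : IsQuasiNorm N) (x : V) : N (-x) = N x := by
  rw [← neg_one_smul ℂ, h.smul, norm_neg, norm_one, one_mul]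

theorem IsQuasiNorm.map_sub_rev (h : IsQuasiNorm N) (x y : V) : N (x - y) = N (y - x) := by
  rw [← neg_sub, h.map_neg]

theorem IsQuasiNorm.hasBasis_comap_nhds_zero (h : IsQuasiNorm N) {α : Type*} (φ : α → V) :
    (comap (N ∘ φ) (𝓝 0)).HasBasis (0 < ·) fun δ => {x | N (φ x) < δ} :=
  (Metric.nhds_basis_ball.comap _).congr (fun _ => Iff.rfl) fun δ _ => by
    ext x
    simp [abs_of_nonneg (h.nonneg _)]

/-- The uniform structure of a quasi-norm `N`, in which the sets `{(x, y) | N (y - x) < δ}`,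
`δ > 0`, form a base of entourages. It turns `QuasiContinuous N` into `Continuous`. -/
@[reducible]
def IsQuasiNorm.uniformSpace (h : IsQuasiNorm N) : UniformSpace V :=
  .ofCore
    { uniformity := comap (N ∘ fun x : V × V => x.2 - x.1) (𝓝 0)
      refl := (h.hasBasis_comap_nhds_zero _).ge_iff.2 fun δ hδ => by
        rintro ⟨x, _⟩ rfl
        simpa [h.map_zero] using hδ
      symm := tendsto_comap_iff.2 <| tendsto_comap.congr fun x => h.map_sub_rev _ _
      comp := by
        obtain ⟨q, hq, htri⟩ := h.quasi_triangle
        have hbasis := h.hasBasis_comap_nhds_zero fun x : V × V => x.2 - x.1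
        refine ((hbasis.lift' (monotone_id.relComp monotone_id)).le_basis_iff hbasis).2
          fun ε hε => ⟨ε / (2 * q), by positivity, ?_⟩
        rintro ⟨x, z⟩ ⟨y, hxy, hyz⟩
        have hle : N (z - x) ≤ q * (N (z - y) + N (y - x)) :=
          sub_add_sub_cancel z y x ▸ htri (z - y) (y - x)
        calc N (z - x) ≤ q * (N (z - y) + N (y - x)) := hle
          _ < q * (ε / (2 * q) + ε / (2 * q)) := by gcongr <;> assumption
          _ = ε := by field_simp; ring }

theorem IsQuasiNorm.hasBasis_nhds (h : IsQuasiNorm N) (x : V) :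
    (@nhds V h.uniformSpace.toTopologicalSpace x).HasBasis (0 < ·) fun δ => {y | N (y - x) < δ} :=
  let := h.uniformSpace
  nhds_basis_uniformity' (h.hasBasis_comap_nhds_zero fun x : V × V => x.2 - x.1)

theorem IsQuasiNorm.quasiContinuous_iff_continuous (h : IsQuasiNorm N) :
    QuasiContinuous N D ↔ @Continuous V ℂ h.uniformSpace.toTopologicalSpace _ D := by
  let := h.uniformSpace
  simp only [continuous_iff_continuousAt, ContinuousAt,
    (h.hasBasis_nhds _).tendsto_iff Metric.nhds_basis_ball, mem_ball_iff_norm]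
  rfl

theorem IsQuasiNorm.dense_iff (h : IsQuasiNorm N) :
    @Dense V h.uniformSpace.toTopologicalSpace S ↔ ∀ x, ∀ ε > 0, ∃ y ∈ S, N (y - x) < ε :=
  let := h.uniformSpace
  forall_congr' fun x => mem_closure_iff_nhds_basis (h.hasBasis_nhds x)

theorem QuasiContinuous.mul (hD : QuasiContinuous N D) (hE : QuasiContinuous N E)
    (h : IsQuasiNorm N) : QuasiContinuous N fun x => D x * E x := by
  let := h.uniformSpace
  rw [h.quasiContinuous_iff_continuous] at *
  exact hD.mul hE

theorem QuasiContinuous.eq_of_dense (hD : QuasiContinuous N D) (hE : QuasiContinuous N E)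
    (h : IsQuasiNorm N) (hS : ∀ x, ∀ ε > 0, ∃ y ∈ S, N (y - x) < ε) (hDE : Set.EqOn D E S) :
    D = E := by
  let := h.uniformSpace
  rw [h.quasiContinuous_iff_continuous] at *
  exact hD.ext_on (h.dense_iff.2 hS) hE hDE

theorem QuasiContinuous.comp_of_le_mul {φ : V → V} {K : ℝ} (hD : QuasiContinuous N D)
    (h : IsQuasiNorm N) (hK : 0 ≤ K) (hφ : ∀ x y, N (φ x - φ y) ≤ K * N (x - y)) :
    QuasiContinuous N fun x => D (φ x) := by
  intro x ε hε
  obtain ⟨δ, hδ, hDδ⟩ := hD (φ x) ε hε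
  refine ⟨δ / (K + 1), by positivity, fun y hy => hDδ _ ?_⟩
  calc N (φ y - φ x) ≤ K * N (y - x) := hφ y x
    _ ≤ (K + 1) * N (y - x) := by linarith [h.nonneg (y - x)]
    _ < δ := (lt_div_iff₀' (by positivity)).1 hy

theorem IsQuasiNorm.exists_quasiContinuous_eqOn (h : IsQuasiNorm N)
    (hS : ∀ x, ∀ ε > 0, ∃ y ∈ S, N (y - x) < ε)
    (hD : ∀ M : ℝ, ∃ K : ℝ, ∀ x ∈ S, ∀ y ∈ S, N x ≤ M → N y ≤ M → ‖D x - D y‖ ≤ K * N (x - y)) :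
    ∃ E : V → ℂ, QuasiContinuous N E ∧ Set.EqOn E D S := by
  let := h.uniformSpace
  obtain ⟨q, hq, htri⟩ := h.quasi_triangle
  simp only [h.quasiContinuous_iff_continuous]
  refine exists_continuous_eqOn_of_dense (h.dense_iff.2 hS) fun x =>
    ⟨{y | N (y - x) < 1}, (h.hasBasis_nhds x).mem_of_mem one_pos, ?_⟩
  have hbound : ∀ y ∈ {y | N (y - x) < 1}, N y ≤ q * (1 + N x) := fun y hy =>
    calc N y ≤ q * (N (y - x) + N x) := by simpa using htri (y - x) x
      _ ≤ q * (1 + N x) := by gcongr; exact hy.le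
  obtain ⟨K, hK⟩ := hD (q * (1 + N x))
  have hdist : ∀ z ∈ ({y | N (y - x) < 1} ∩ S) ×ˢ ({y | N (y - x) < 1} ∩ S),
      dist (D z.1) (D z.2) ≤ K * N (z.2 - z.1) := fun z hz => by
    rw [dist_eq_norm, h.map_sub_rev z.2]
    exact hK _ hz.1.2 _ hz.2.2 (hbound _ hz.1.1) (hbound _ hz.2.1)
  rw [UniformContinuousOn, Metric.uniformity_eq_comap_nhds_zero, tendsto_comap_iff]
  have hlim : Tendsto (fun z : V × V => N (z.2 - z.1)) (𝓤 V) (𝓝 0) := tendsto_comap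
  have hKlim : Tendsto (fun z : V × V => K * N (z.2 - z.1)) (𝓤 V) (𝓝 0) :=
    mul_zero K ▸ hlim.const_mul K
  exact squeeze_zero' (.of_forall fun _ => dist_nonneg)
    (Filter.eventually_inf_principal.2 (.of_forall hdist)) (hKlim.mono_left inf_le_left)

end QuasiNorm

section Lipschitz

open Metric

theorem dist_le_of_norm_le_on_ball {E : Type*} [NormedAddCommGroup E] [NormedSpace ℂ E]
    {f : ℂ → E} {c z : ℂ} {B R : ℝ} (hd : DifferentiableOn ℂ f (ball c R))
    (hB : ∀ w ∈ ball c R, ‖f w‖ ≤ B) (hz : z ∈ ball c R) :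
    dist (f z) (f c) ≤ 2 * B / R * dist z c := by
  refine Complex.dist_le_div_mul_dist_of_mapsTo_ball hd (fun w hw => ?_) hz
  have hc : c ∈ ball c R := mem_ball_self (pos_of_mem_ball hz)
  rw [mem_closedBall, dist_eq_norm, two_mul]
  exact norm_sub_le_of_le (hB w hw) (hB c hc)

variable {V : Type*} [AddCommGroup V] [Module ℂ V] {N : V → ℝ} {D : V → ℂ} {S : Submodule ℂ V}

/-- A Schwarz lemma argument on the complex line through `x` and `y`, where `D` is entire and
bounded on a disc of radius `1 + 1 / N (x - y)`. -/
theorem IsQuasiNorm.exists_norm_sub_le_of_differentiable (h : IsQuasiNorm N)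
    (hd : ∀ x ∈ S, ∀ y ∈ S, Differentiable ℂ fun z : ℂ => D (x + z • y))
    (hD : ∀ M : ℝ, ∃ B : ℝ, ∀ x ∈ S, N x ≤ M → ‖D x‖ ≤ B) (M : ℝ) :
    ∃ K : ℝ, ∀ x ∈ S, ∀ y ∈ S, N x ≤ M → N y ≤ M → ‖D x - D y‖ ≤ K * N (x - y) := by
  obtain ⟨q, hq, htri⟩ := h.quasi_triangle
  obtain ⟨B, hB⟩ := hD (q * (M + (q * (M + M) + 1)))
  refine ⟨2 * B, fun x hx y hy hxM hyM => ?_⟩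
  rcases (h.nonneg (x - y)).eq_or_lt with hρ | hρ
  · obtain rfl : x = y := sub_eq_zero.1 ((h.eq_zero_iff _).1 hρ.symm)
    simp [h.map_zero]
  have hρM : N (x - y) ≤ q * (M + M) := by
    rw [sub_eq_add_neg]
    refine (htri _ _).trans ?_
    rw [h.map_neg]
    gcongr
  have hbound : ∀ z ∈ ball (0 : ℂ) (1 + (N (x - y))⁻¹), ‖D (y + z • (x - y))‖ ≤ B := by
    refine fun z hz => hB _ (S.add_mem hy (S.smul_mem z (S.sub_mem hx hy))) ?_
    have hzN : ‖z‖ * N (x - y) ≤ q * (M + M) + 1 :=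
      calc ‖z‖ * N (x - y) ≤ (1 + (N (x - y))⁻¹) * N (x - y) := by
            gcongr
            exact (mem_ball_zero_iff.1 hz).le
        _ = N (x - y) + 1 := by field_simp
        _ ≤ q * (M + M) + 1 := by gcongr
    refine (htri _ _).trans ?_
    rw [h.smul]
    gcongr
  have hB0 : 0 ≤ B := (norm_nonneg _).trans (hbound 0 (mem_ball_self (by positivity)))
  have hone : (1 : ℂ) ∈ ball 0 (1 + (N (x - y))⁻¹) := by simpa using hρ
  calc ‖D x - D y‖ ≤ 2 * B / (1 + (N (x - y))⁻¹) := by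
        simpa [dist_eq_norm] using dist_le_of_norm_le_on_ball
          (hd y hy (x - y) (S.sub_mem hx hy)).differentiableOn hbound hone
    _ ≤ 2 * B / (N (x - y))⁻¹ := by gcongr; linarith
    _ = 2 * B * N (x - y) := div_inv_eq_mul _ _

end Lipschitz

/-! ### Regularized determinants on `l_p`-ideals -/

section

theorem pow_sub_pow_eq_sum {R : Type*} [Ring R] (a b : R) (k : ℕ) :
    a ^ k - b ^ k = ∑ m ∈ Finset.range k, a ^ (k - 1 - m) * ((a - b) * b ^ m) := by
  have hterm : ∀ m ∈ Finset.range k, a ^ (k - 1 - m) * ((a - b) * b ^ m) =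
      a ^ (k - m) * b ^ m - a ^ (k - (m + 1)) * b ^ (m + 1) := fun m hm => by
    obtain ⟨j, rfl⟩ := Nat.exists_eq_add_of_lt (Finset.mem_range.1 hm)
    rw [show m + j + 1 - 1 - m = j by omega, show m + j + 1 - m = j + 1 by omega,
      show m + j + 1 - (m + 1) = j by omega, pow_succ a, pow_succ' b]
    noncomm_ring
  rw [Finset.sum_congr rfl hterm, Finset.sum_range_sub']
  simp

variable {X : Type*} [NormedAddCommGroup X] [NormedSpace ℂ X]
  {p : ℝ} {𝓘 : Submodule ℂ (X →L[ℂ] X)} {N : 𝓘 → ℝ}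

theorem FiniteRank.tr_pow_eq_add_sum {F L : X →L[ℂ] X} (hF : FiniteRank F) (hL : FiniteRank L)
    (k : ℕ) : tr ((F + L - F * L) ^ k) = tr (L ^ k) + ∑ m ∈ Finset.range k,
      tr (F * (1 - L) * L ^ m * (F + L - F * L) ^ (k - 1 - m)) := by
  rcases k with _ | j
  · simp
  set H := F + L - F * L with hH
  have hsub : H - L = F * (1 - L) := by rw [hH]; noncomm_ring
  have hrank (m : ℕ) : FiniteRank (F * (1 - L) * L ^ m) := (hF.mul_right _).mul_right _
  have hpow : H ^ (j + 1) = L ^ (j + 1) +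
      ∑ m ∈ Finset.range (j + 1), H ^ (j + 1 - 1 - m) * (F * (1 - L) * L ^ m) := by
    rw [← hsub, ← pow_sub_pow_eq_sum, add_sub_cancel]
  have hLpow : FiniteRank (L ^ (j + 1)) := pow_succ' L j ▸ hL.mul_right _
  rw [hpow, hLpow.tr_add ((finiteRankOperators X).sum_mem fun m _ => (hrank m).mul_left _),
    tr_sum _ fun m => (hrank m).mul_left _]
  simp only [(hrank _).tr_mul_comm]

theorem FiniteRank.regDetFin_mul {F L : X →L[ℂ] X} (hF : FiniteRank F) (hL : FiniteRank L)
    (p : ℝ) : regDetFin p (F + L - F * L) = detOneSub F * regDetFin p L *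
      Complex.exp (∑ k ∈ Finset.Ico 1 ⌈p⌉₊, ∑ m ∈ Finset.range k,
        tr (F * (1 - L) * L ^ m * (F + L - F * L) ^ (k - 1 - m)) / (k : ℂ)) := by
  simp only [regDetFin, hF.detOneSub_mul hL, hF.tr_pow_eq_add_sum hL, add_div,
    Finset.sum_add_distrib, Complex.exp_add, ← Finset.sum_div, mul_assoc]

theorem IsLpIdeal.eq_of_eq_of_finiteRank (h : IsLpIdeal p 𝓘 N) {D E : 𝓘 → ℂ}
    (hD : QuasiContinuous N D) (hE : QuasiContinuous N E)
    (hDE : ∀ F : 𝓘, FiniteRank (F : X →L[ℂ] X) → D F = E F) : D = E :=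
  hD.eq_of_dense (S := {F | FiniteRank (F : X →L[ℂ] X)}) hE h.quasiNorm h.dense hDE

theorem IsLpIdeal.exists_eigenvalueLpNorm_le (h : IsLpIdeal p 𝓘 N) :
    ∃ γ : ℝ, 0 ≤ γ ∧ ∀ (L : 𝓘) (M : ℝ), N L ≤ M →
      eigenvalueLpNorm p (L : X →L[ℂ] X) ≤ ENNReal.ofReal (γ * M) := by
  obtain ⟨γ, hγ⟩ := h.eigenvalue_le
  refine ⟨γ, γ.coe_nonneg, fun L M hM => (hγ L).trans ?_⟩
  rw [ENNReal.ofReal_mul γ.coe_nonneg, ENNReal.ofReal_coe_nnreal]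
  gcongr

theorem IsLpIdeal.exists_norm_regDetFin_le [CompleteSpace X] (h : IsLpIdeal p 𝓘 N) (hp : 0 < p)
    (M : ℝ) : ∃ B : ℝ, ∀ F : 𝓘, FiniteRank (F : X →L[ℂ] X) → N F ≤ M →
      ‖regDetFin p (F : X →L[ℂ] X)‖ ≤ B := by
  obtain ⟨γ, hγ, hγN⟩ := h.exists_eigenvalueLpNorm_le
  obtain ⟨C, -, hbound⟩ := RegDet.exists_norm_regDetFin_le X hp
  exact ⟨Real.exp (C * (γ * M) ^ p), fun F hF hFM => hbound F hF (γ * M)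
    (mul_nonneg hγ ((h.quasiNorm.nonneg F).trans hFM)) (hγN F M hFM)⟩

theorem IsLpIdeal.existsUnique_isRegDet [CompleteSpace X] (h : IsLpIdeal p 𝓘 N) (hp : 0 < p) :
    ∃! D : 𝓘 → ℂ, IsRegDet p 𝓘 N D := by
  let S : Submodule ℂ 𝓘 := (finiteRankOperators X).comap 𝓘.subtype
  have hlip := h.quasiNorm.exists_norm_sub_le_of_differentiable (S := S)
    (D := fun F : 𝓘 => regDetFin p (F : X →L[ℂ] X))
    (fun F hF G hG => FiniteRank.differentiable_regDetFin_add_smul hF hG p)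
    (h.exists_norm_regDetFin_le hp)
  obtain ⟨D, hD, hDF⟩ := h.quasiNorm.exists_quasiContinuous_eqOn (S := S) h.dense hlip
  exact ⟨D, ⟨hD, hDF⟩, fun E hE => h.eq_of_eq_of_finiteRank hE.continuous hD fun F hF =>
    (hE.extends_fin F hF).trans (hDF hF).symm⟩

theorem IsLpIdeal.isRegDet_regDet [CompleteSpace X] (h : IsLpIdeal p 𝓘 N) (hp : 0 < p) :
    IsRegDet p 𝓘 N (regDet p 𝓘 N) := by
  have hex := (h.existsUnique_isRegDet hp).exists
  rw [regDet, dif_pos hex]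
  exact hex.choose_spec

theorem IsLpIdeal.quasiContinuous_comp_coe (h : IsLpIdeal p 𝓘 N) {g : (X →L[ℂ] X) → ℂ}
    (hg : Continuous g) : QuasiContinuous N fun L : 𝓘 => g L := by
  intro L ε hε
  obtain ⟨δ, hδ, hgδ⟩ := Metric.continuous_iff.1 hg L ε hε
  refine ⟨δ, hδ, fun K hK => ?_⟩
  rw [← dist_eq_norm]
  exact hgδ K ((dist_eq_norm _ _).trans_lt ((h.opNorm_le (K - L)).trans_lt hK))

theorem IsLpIdeal.norm_mul_right_le (h : IsLpIdeal p 𝓘 N) (L : 𝓘) (B : X →L[ℂ] X) :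
    N ⟨(L : X →L[ℂ] X) * B, h.mul_right_mem L B⟩ ≤ ‖B‖ * N L := by
  have hle := h.norm_mul_mul_le 1 L B
  simp only [one_mul] at hle
  refine hle.trans ((mul_comm _ _).trans_le ?_)
  gcongr
  exact mul_le_of_le_one_left (h.quasiNorm.nonneg L) ContinuousLinearMap.norm_id_le

theorem IsLpIdeal.norm_mul_left_le (h : IsLpIdeal p 𝓘 N) (B : X →L[ℂ] X) (L : 𝓘) :
    N ⟨B * (L : X →L[ℂ] X), h.mul_left_mem B L⟩ ≤ ‖B‖ * N L := by
  have hle := h.norm_mul_mul_le B L 1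
  simp only [mul_one] at hle
  exact hle.trans (mul_le_of_le_one_right (mul_nonneg (norm_nonneg B) (h.quasiNorm.nonneg L))
    ContinuousLinearMap.norm_id_le)

theorem IsLpIdeal.regDet_mul_comm [CompleteSpace X] (h : IsLpIdeal p 𝓘 N) (hp : 0 < p) (L : 𝓘)
    (B : X →L[ℂ] X) :
    regDet p 𝓘 N ⟨(L : X →L[ℂ] X) * B, h.mul_right_mem L B⟩ =
      regDet p 𝓘 N ⟨B * (L : X →L[ℂ] X), h.mul_left_mem B L⟩ := by
  have hD := h.isRegDet_regDet hp
  have hright := hD.continuous.comp_of_le_mul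
    (φ := fun L => ⟨(L : X →L[ℂ] X) * B, h.mul_right_mem L B⟩) h.quasiNorm (norm_nonneg B)
    fun K L => (congrArg N (Subtype.ext (sub_mul _ _ _).symm)).trans_le
      (h.norm_mul_right_le (K - L) B)
  have hleft := hD.continuous.comp_of_le_mul
    (φ := fun L => ⟨B * (L : X →L[ℂ] X), h.mul_left_mem B L⟩) h.quasiNorm (norm_nonneg B)
    fun K L => (congrArg N (Subtype.ext (mul_sub _ _ _).symm)).trans_le
      (h.norm_mul_left_le B (K - L))
  refine congrFun (h.eq_of_eq_of_finiteRank hright hleft fun F hF => ?_) L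
  exact (hD.extends_fin ⟨_, h.mul_right_mem F B⟩ (hF.mul_right B)).trans <|
    (hF.regDetFin_mul_comm p B).trans
      (hD.extends_fin ⟨_, h.mul_left_mem B F⟩ (hF.mul_left B)).symm

theorem IsLpIdeal.norm_one_sub_mul_sub_le (h : IsLpIdeal p 𝓘 N) {F : X →L[ℂ] X}
    (hF : FiniteRank F) (K L : 𝓘) :
    N (⟨_, h.one_sub_mul_mem hF K⟩ - ⟨_, h.one_sub_mul_mem hF L⟩) ≤ ‖1 - F‖ * N (K - L) := by
  refine (congrArg N (Subtype.ext ?_)).trans_le (h.norm_mul_left_le (1 - F) (K - L))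
  simp only [Submodule.coe_sub]
  noncomm_ring

theorem FiniteRank.continuous_exp_sum_tr {F : X →L[ℂ] X} (hF : FiniteRank F) (n : ℕ) :
    Continuous fun L : X →L[ℂ] X => Complex.exp (∑ k ∈ Finset.Ico 1 n, ∑ m ∈ Finset.range k,
      tr (F * (1 - L) * L ^ m * (F + L - F * L) ^ (k - 1 - m)) / (k : ℂ)) := by
  simp only [mul_assoc F]
  refine Complex.continuous_exp.comp (continuous_finsetSum _ fun k _ =>
    continuous_finsetSum _ fun m _ => (hF.continuous_tr_mul.comp ?_).div_const _)
  fun_prop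

theorem IsLpIdeal.regDet_mul [CompleteSpace X] (h : IsLpIdeal p 𝓘 N) (hp : 0 < p) (L : 𝓘)
    {F : X →L[ℂ] X} (hF : FiniteRank F) :
    regDet p 𝓘 N ⟨1 - (1 - F) * (1 - (L : X →L[ℂ] X)), h.one_sub_mul_mem hF L⟩ =
      detOneSub F * regDet p 𝓘 N L *
        Complex.exp (∑ k ∈ Finset.Ico 1 ⌈p⌉₊, ∑ m ∈ Finset.range k,
          tr (F * (1 - (L : X →L[ℂ] X)) * (L : X →L[ℂ] X) ^ m *
            (F + (L : X →L[ℂ] X) - F * (L : X →L[ℂ] X)) ^ (k - 1 - m)) / (k : ℂ)) := by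
  have hD := h.isRegDet_regDet hp
  have hleft := hD.continuous.comp_of_le_mul
    (φ := fun L => ⟨1 - (1 - F) * (1 - (L : X →L[ℂ] X)), h.one_sub_mul_mem hF L⟩) h.quasiNorm
    (norm_nonneg (1 - F)) (h.norm_one_sub_mul_sub_le hF)
  have hconst : QuasiContinuous N fun _ => detOneSub F :=
    h.quasiContinuous_comp_coe continuous_const
  have hright := (hconst.mul hD.continuous h.quasiNorm).mul
    (h.quasiContinuous_comp_coe (hF.continuous_exp_sum_tr ⌈p⌉₊)) h.quasiNorm
  refine congrFun (h.eq_of_eq_of_finiteRank hleft hright fun K hK => ?_) L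
  have hH : 1 - (1 - F) * (1 - (K : X →L[ℂ] X)) = F + K - F * K := by noncomm_ring
  have hHrank : FiniteRank (1 - (1 - F) * (1 - (K : X →L[ℂ] X))) := by
    rw [hH]
    exact (finiteRankOperators X).sub_mem ((finiteRankOperators X).add_mem hF hK) (hF.mul_right _)
  rw [hD.extends_fin K hK, ← hF.regDetFin_mul hK p]
  exact (hD.extends_fin ⟨_, h.one_sub_mul_mem hF K⟩ hHrank).trans (congrArg (regDetFin p) hH)

/-- The lower bound for `|det_p (I - F)|`, `F` small of finite rank, is uniform and hence survives
the passage to the limit. -/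
theorem IsLpIdeal.exists_regDet_ne_zero_of_lt [CompleteSpace X] (h : IsLpIdeal p 𝓘 N)
    (hp : 0 < p) : ∃ δ > 0, ∀ L : 𝓘, N L < δ → regDet p 𝓘 N L ≠ 0 := by
  have hD := h.isRegDet_regDet hp
  obtain ⟨q, hq, htri⟩ := h.quasiNorm.quasi_triangle
  obtain ⟨γ, hγ, hγN⟩ := h.exists_eigenvalueLpNorm_le
  refine ⟨1 / (4 * q), by positivity, fun L hL h0 => ?_⟩
  obtain ⟨δ, hδ, hDδ⟩ := hD.continuous L _ (Real.exp_pos (-2 * (γ * (1 / 2)) ^ p))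
  obtain ⟨F, hF, hFL⟩ := h.dense L (min δ (1 / (4 * q))) (by positivity)
  have hNF : N F ≤ 1 / 2 :=
    calc N F ≤ q * (N (F - L) + N L) := by simpa using htri (F - L) L
      _ ≤ q * (1 / (4 * q) + 1 / (4 * q)) := by
          gcongr
          exact hFL.le.trans (min_le_right _ _)
      _ = 1 / 2 := by field_simp; norm_num
  have hlt : ‖regDetFin p (F : X →L[ℂ] X)‖ < Real.exp (-2 * (γ * (1 / 2)) ^ p) := by
    simpa [h0, hD.extends_fin F hF] using hDδ F (hFL.trans_le (min_le_left _ _))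
  exact hlt.not_ge (hF.exp_neg_le_norm_regDetFin hp ((h.opNorm_le F).trans hNF) (by positivity)
    (hγN F _ hNF))

theorem IsLpIdeal.exists_one_sub_mul_one_sub_eq [CompleteSpace X] (h : IsLpIdeal p 𝓘 N) (L : 𝓘)
    {δ : ℝ} (hδ : 0 < δ) : ∃ (F : X →L[ℂ] X) (K : 𝓘), FiniteRank F ∧ N K < δ ∧
      IsUnit (1 - (K : X →L[ℂ] X)) ∧ (1 - F) * (1 - (K : X →L[ℂ] X)) = 1 - L := by
  obtain ⟨G, hG, hGL⟩ := h.dense L (min δ 1) (by positivity)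
  rw [h.quasiNorm.map_sub_rev] at hGL
  have hunit : IsUnit (1 - ((L - G : 𝓘) : X →L[ℂ] X)) :=
    isUnit_one_sub_of_norm_lt_one ((h.opNorm_le _).trans_lt (hGL.trans_le (min_le_right _ _)))
  refine ⟨G * ↑hunit.unit⁻¹, L - G, hG.mul_right _, hGL.trans_le (min_le_left _ _), hunit, ?_⟩
  rw [sub_mul, mul_assoc, hunit.val_inv_mul, one_mul, mul_one, Submodule.coe_sub]
  abel

theorem IsLpIdeal.regDet_ne_zero_iff [CompleteSpace X] (h : IsLpIdeal p 𝓘 N) (hp : 0 < p)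
    (L : 𝓘) : regDet p 𝓘 N L ≠ 0 ↔ IsUnit (1 - (L : X →L[ℂ] X)) := by
  obtain ⟨δ, hδ, hne⟩ := h.exists_regDet_ne_zero_of_lt hp
  obtain ⟨F, K, hF, hKδ, hK, hFK⟩ := h.exists_one_sub_mul_one_sub_eq L hδ
  have hmul := h.regDet_mul hp K hF
  simp only [hFK, sub_sub_cancel, Subtype.coe_eta] at hmul
  have hunit : IsUnit (1 - (L : X →L[ℂ] X)) ↔ detOneSub F ≠ 0 := by
    rw [← hFK, ← hF.isUnit_one_sub_iff, ← hK.unit_spec, Units.isUnit_mul_units]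
  rw [hunit, hmul, mul_ne_zero_iff, mul_ne_zero_iff]
  exact ⟨fun hprod => hprod.1.1, fun hF0 => ⟨⟨hF0, hne K hKδ⟩, Complex.exp_ne_zero _⟩⟩

end

end RegDet

end

theorem proposition4p7 {X : Type*} [NormedAddCommGroup X] [NormedSpace ℂ X] [CompleteSpace X]
    {p : ℝ} (hp : 0 < p) (𝓘 : Submodule ℂ (X →L[ℂ] X)) (N : 𝓘 → ℝ)
    (h𝓘 : RegDet.IsLpIdeal p 𝓘 N) :
    -- the regularized determinant is well defined
    (∃! D : 𝓘 → ℂ, RegDet.IsRegDet p 𝓘 N D) ∧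
    -- `det (I - LB) = det (I - BL)`
    (∀ (L : 𝓘) (B : X →L[ℂ] X),
      RegDet.regDet p 𝓘 N ⟨(L : X →L[ℂ] X) * B, h𝓘.mul_right_mem L B⟩ =
        RegDet.regDet p 𝓘 N ⟨B * (L : X →L[ℂ] X), h𝓘.mul_left_mem B L⟩) ∧
    -- the product formula, with `H = F + L - FL`, so that `(I - F)(I - L) = I - H`
    (∀ (L : 𝓘) (F : X →L[ℂ] X) (hF : RegDet.FiniteRank F) (H : X →L[ℂ] X),
      H = F + (L : X →L[ℂ] X) - F * (L : X →L[ℂ] X) →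
      RegDet.regDet p 𝓘 N
          ⟨1 - (1 - F) * (1 - (L : X →L[ℂ] X)), h𝓘.one_sub_mul_mem hF L⟩ =
        RegDet.detOneSub F * RegDet.regDet p 𝓘 N L *
          Complex.exp (∑ k ∈ Finset.Ico 1 ⌈p⌉₊, ∑ m ∈ Finset.range k,
            RegDet.tr (F * (1 - (L : X →L[ℂ] X)) * (L : X →L[ℂ] X) ^ m * H ^ (k - 1 - m)) /
              (k : ℂ))) ∧
    -- `det (I - L) ≠ 0` if and only if `I - L` is invertible in `B(X)`
    (∀ L : 𝓘, RegDet.regDet p 𝓘 N L ≠ 0 ↔ IsUnit (1 - (L : X →L[ℂ] X))) := by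
  refine ⟨h𝓘.existsUnique_isRegDet hp, h𝓘.regDet_mul_comm hp, ?_, h𝓘.regDet_ne_zero_iff hp⟩
  rintro L F hF _ rfl
  exact h𝓘.regDet_mul hp L hF
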